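/- Let $G$ be a three-dimensional Lie group with a bi-invariant Riemannian metric $\langle\cdot,\cdot\rangle$ and Lie algebra $\mathfrak g$. Vector fields along a curve in $G$ are written in a left-invariant frame, i.e. as $\mathfrak g$-valued functions; then the Levi-Civita covariant derivative along a unit-speed curve with tangent $T$ is $D_TW=W'+\tfrac12[T,W]$. Let $\alpha:I\to G$ and $\tilde\alpha:J\to G$ ($I,J\subset\mathbb R$ open intervals) be smooth unit-speed curves with positive curvature and Frenet apparatus $(T,N,B,\kappa,\tau)$ and $(\tilde T,\tilde N,\tilde B,\tilde\kappa,\tilde\tau)$, so $D_TT=\kappa N$, $D_TN=-\kappa T+\tau B$, $D_TB=-\tau N$, and similarly for $\tilde\alpha$. Put $\tau_G=\tfrac12\langle[T,N],B\rangle$, $\tilde\tau_G=\tfrac12\langle[\tilde T,\tilde N],\tilde B\rangle$, and $$\tilde H=\frac{\tilde\tau-\tilde\tau_G}{\tilde\kappa},\qquad \rho=\frac{(\tilde\tau-\tilde\tau_G)'}{\tilde\kappa'} ,$$ where primes on quantities of $\tilde\alpha$ denote derivatives with respect to its arc length. Suppose that $(\alpha,\tilde\alpha)$ is a Bertrand pair: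 there is a smooth bijection $\varphi:I\to J$ such that for every $s\in I$ the principal normal lines of $\alpha$ at $s$ and of $\tilde\alpha$ at $\varphi(s)$ coincide, that is, $\tilde\alpha(\varphi(s))=\alpha(s)\exp(r(s)N(s))$ with a smooth function $r$, and $\tilde N(\varphi(s))$ is a multiple of $N(s)$ (the principal normal line being the geodesic $t\mapsto\alpha(s)\exp(tN(s))$); here trivial mates are excluded, i.e. there is no $z\in G$ with $\tilde\alpha(\varphi(s))=\alpha(s)z$ for all $s\in I$. Suppose further that neither curve is a general helix (the tangent makes a constant angle with some fixed nonzero left-invariant vector field), that neither curve is planar ($\tau-\tau_G\equiv0$, respectively $\tilde\tau-\tilde\tau_G\equiv0$), and that $\tilde\kappa$ is not constant. Then the tangent indicatrix $s\mapsto T(s)$ of $\alpha$, a curve in the unit sphere of $\mathfrak g$, is a spherical helix (a regular curve in the sphere whose tangent makes a constant angle with some fixed nonzero vector of $\mathfrak g$) if and only if $$\tilde\kappa''\,\tilde\kappa\,(1+\tilde H^2)-3\,\tilde\kappa'^{\,2}\,(1+\rho\tilde H)=0\qquad\text{on } J,$$ where $\tilde\kappa'^{\,2}\rho$ is read as $\tilde\kappa'(\tilde\tau-\tilde\tau_G)'=0$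 at points where $\tilde\kappa'=0$. -/

import Mathlib

open scoped Manifold ContDiff

noncomputable section BertrandLie

variable {E : Type*} [NormedAddCommGroup E] [NormedSpace ℝ E]
  {G : Type*} [TopologicalSpace G] [ChartedSpace E G] [Group G]

/-- A smooth Riemannian metric on the Lie group `G`. -/
abbrev LieMetric (E : Type*) [NormedAddCommGroup E] [NormedSpace ℝ E]
    (G : Type*) [TopologicalSpace G] [ChartedSpace E G] [Group G] [LieGroup 𝓘(ℝ, E) ∞ G] :=
  Bundle.ContMDiffRiemannianMetric 𝓘(ℝ, E) ∞ E (fun x : G => TangentSpace 𝓘(ℝ, E) x)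

/-- The metric is bi-invariant: all left and all right translations are isometries. -/
structure IsBiInvariant [LieGroup 𝓘(ℝ, E) ∞ G] (g : LieMetric E G) : Prop where
  left : ∀ (a x : G) (v w : TangentSpace 𝓘(ℝ, E) x),
    g.inner (a * x) (mfderiv 𝓘(ℝ, E) 𝓘(ℝ, E) (fun y : G => a * y) x v)
      (mfderiv 𝓘(ℝ, E) 𝓘(ℝ, E) (fun y : G => a * y) x w) = g.inner x v w
  right : ∀ (a x : G) (v w : TangentSpace 𝓘(ℝ, E) x),
    g.inner (x * a) (mfderiv 𝓘(ℝ, E) 𝓘(ℝ, E) (fun y : G => y * a) x v)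
      (mfderiv 𝓘(ℝ, E) 𝓘(ℝ, E) (fun y : G => y * a) x w) = g.inner x v w

/-- The scalar product which the metric induces on the Lie algebra `𝔤 = T₁G`. -/
def algInner [LieGroup 𝓘(ℝ, E) ∞ G] (g : LieMetric E G) (X Y : GroupLieAlgebra 𝓘(ℝ, E) G) : ℝ :=
  g.inner 1 X Y

/-- Vector fields along a curve in `G` are written in a left-invariant frame, i.e. as functions
`W : ℝ → 𝔤`. If the curve has velocity `T` (so written), then the Levi-Civita covariant derivative
of `W` along the curve is `W' + (1/2) [T, W]`. -/
def covDeriv (T W : ℝ → GroupLieAlgebra 𝓘(ℝ, E) G) (s : ℝ) : GroupLieAlgebra 𝓘(ℝ, E) G :=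
  deriv W s + (1 / 2 : ℝ) • ⁅T s, W s⁆

/-- Data `(T, N, B, κ, τ)` along a curve; the vector fields are written in a left-invariant
frame. -/
structure FrenetData (E : Type*) [NormedAddCommGroup E] [NormedSpace ℝ E]
    (G : Type*) [TopologicalSpace G] [ChartedSpace E G] [Group G] where
  T : ℝ → GroupLieAlgebra 𝓘(ℝ, E) G
  N : ℝ → GroupLieAlgebra 𝓘(ℝ, E) G
  B : ℝ → GroupLieAlgebra 𝓘(ℝ, E) G
  κ : ℝ → ℝ
  τ : ℝ → ℝ

/-- `α` is a smooth curve on the open interval `I`, parametrized by arc length and with nonvanishing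
curvature, and `F` is its Frenet apparatus. (It is unique up to the sign of `B` and `τ`, that is, up
to the choice of an orientation.) -/
structure IsFrenetCurve [LieGroup 𝓘(ℝ, E) ∞ G] (g : LieMetric E G)
    (I : Set ℝ) (α : ℝ → G) (F : FrenetData E G) : Prop where
  isOpen : IsOpen I
  ordConnected : I.OrdConnected
  smooth : ContMDiffOn 𝓘(ℝ, ℝ) 𝓘(ℝ, E) ∞ α I
  smooth_T : ContDiffOn ℝ ∞ (F := E) F.T I
  smooth_N : ContDiffOn ℝ ∞ (F := E) F.N I
  smooth_B : ContDiffOn ℝ ∞ (F := E) F.B I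
  /-- the velocity of `α` is `T`, i.e. `α'(s)` is the left translate of `T s` to `α s` -/
  velocity : ∀ s ∈ I, HasMFDerivAt 𝓘(ℝ, ℝ) 𝓘(ℝ, E) α s
    ((1 : ℝ →L[ℝ] ℝ).smulRight (mulInvariantVectorField (F.T s) (α s)))
  /-- `(T, N, B)` is orthonormal; in particular the speed is `1` -/
  inner_TT : ∀ s ∈ I, algInner g (F.T s) (F.T s) = 1
  inner_NN : ∀ s ∈ I, algInner g (F.N s) (F.N s) = 1
  inner_BB : ∀ s ∈ I, algInner g (F.B s) (F.B s) = 1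
  inner_TN : ∀ s ∈ I, algInner g (F.T s) (F.N s) = 0
  inner_TB : ∀ s ∈ I, algInner g (F.T s) (F.B s) = 0
  inner_NB : ∀ s ∈ I, algInner g (F.N s) (F.B s) = 0
  curvature_pos : ∀ s ∈ I, 0 < F.κ s
  /-- the Frenet formulas -/
  frenet_T : ∀ s ∈ I, covDeriv F.T F.T s = F.κ s • F.N s
  frenet_N : ∀ s ∈ I, covDeriv F.T F.N s = -F.κ s • F.T s + F.τ s • F.B s
  frenet_B : ∀ s ∈ I, covDeriv F.T F.B s = -F.τ s • F.N s

/-- `τ_G = (1/2) ⟨[T, N], B⟩`. -/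
def FrenetData.tauG [LieGroup 𝓘(ℝ, E) ∞ G] (g : LieMetric E G) (F : FrenetData E G) (s : ℝ) : ℝ :=
  (1 / 2) * algInner g ⁅F.T s, F.N s⁆ (F.B s)

/-- The harmonic curvature function `H = (τ - τ_G) / κ`. -/
def FrenetData.harm [LieGroup 𝓘(ℝ, E) ∞ G] (g : LieMetric E G) (F : FrenetData E G) (s : ℝ) : ℝ :=
  (F.τ s - F.tauG g s) / F.κ s

/-- `ρ = (τ - τ_G)' / κ'`. -/
def FrenetData.rho [LieGroup 𝓘(ℝ, E) ∞ G] (g : LieMetric E G) (F : FrenetData E G) (s : ℝ) : ℝ :=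
  deriv (fun u => F.τ u - F.tauG g u) s / deriv F.κ s

/-- General helix: the unit tangent makes a constant angle with a fixed nonzero left-invariant
vector field. -/
def FrenetData.IsHelix [LieGroup 𝓘(ℝ, E) ∞ G] (g : LieMetric E G) (I : Set ℝ)
    (F : FrenetData E G) : Prop :=
  ∃ d : GroupLieAlgebra 𝓘(ℝ, E) G, d ≠ 0 ∧ ∃ c : ℝ, ∀ s ∈ I, algInner g (F.T s) d = c

/-- Planar curve: `τ - τ_G` vanishes identically, i.e. `B` is a constant vector of `𝔤`. -/
def FrenetData.IsPlanar [LieGroup 𝓘(ℝ, E) ∞ G] (g : LieMetric E G) (I : Set ℝ)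
    (F : FrenetData E G) : Prop :=
  ∀ s ∈ I, F.τ s = F.tauG g s

/-- The tangent indicatrix: the curve `s ↦ T s` in the unit sphere of `𝔤`. -/
def FrenetData.tangentIndicatrix (F : FrenetData E G) : ℝ → GroupLieAlgebra 𝓘(ℝ, E) G := F.T

/-- Spherical helix in the Euclidean space `𝔤`: a regular smooth curve in the unit sphere whose unit
tangent makes a constant angle with a fixed nonzero vector. -/
structure IsSphericalHelix [LieGroup 𝓘(ℝ, E) ∞ G] (g : LieMetric E G) (I : Set ℝ)
    (c : ℝ → GroupLieAlgebra 𝓘(ℝ, E) G) : Prop where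
  smooth : ContDiffOn ℝ ∞ (F := E) c I
  mem_sphere : ∀ s ∈ I, algInner g (c s) (c s) = 1
  regular : ∀ s ∈ I, deriv c s ≠ 0
  const_angle : ∃ d : GroupLieAlgebra 𝓘(ℝ, E) G, d ≠ 0 ∧ ∃ k : ℝ, ∀ s ∈ I,
    algInner g ((√(algInner g (deriv c s) (deriv c s)))⁻¹ • deriv c s) d = k

/-- `Γ s` is, for each `s ∈ I`, the principal normal line of `α` at `s`: the geodesic which starts at
`α s` with velocity `N s`. (The geodesics of a bi-invariant metric are the integral curves of the
left-invariant vector fields, `Γ s t = α s * exp (t N s)`, so this `Γ` exists, is unique and is smooth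
in both variables; in a vector space it is `α s + t N s`.) -/
structure IsPrincipalNormalLines (I : Set ℝ) (α : ℝ → G) (F : FrenetData E G)
    (Γ : ℝ → ℝ → G) : Prop where
  smooth : ContMDiffOn 𝓘(ℝ, ℝ × ℝ) 𝓘(ℝ, E) ∞ (fun p : ℝ × ℝ => Γ p.1 p.2) (I ×ˢ Set.univ)
  start : ∀ s ∈ I, Γ s 0 = α s
  geodesic : ∀ s ∈ I, IsMIntegralCurve (Γ s) (mulInvariantVectorField (I := 𝓘(ℝ, E)) (F.N s))

/-- `(α, β)` is a Bertrand pair: there is a smooth bijective correspondence `s ↦ φ s` of the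
parameters such that at corresponding points the principal normal lines coincide, i.e. `β (φ s)` lies
on the principal normal line of `α` at `s` (at signed distance `r s`), and the principal normal of `β`
at `φ s` is tangent to that line. As usual, the trivial mates are left out (in `ℝ³` only `β = α`):
`β` is not obtained from `α` by multiplication with a fixed element. Otherwise every curve would be
paired with itself, and every curve in `SU(2)` with its antipodal curve. -/
def IsBertrandPair (I : Set ℝ) (α : ℝ → G) (F : FrenetData E G)
    (J : Set ℝ) (β : ℝ → G) (F' : FrenetData E G) : Prop :=
  ∃ φ r : ℝ → ℝ, ∃ Γ : ℝ → ℝ → G,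
    ContDiffOn ℝ ∞ φ I ∧ Set.BijOn φ I J ∧ ContDiffOn ℝ ∞ r I ∧
    IsPrincipalNormalLines I α F Γ ∧
    (∀ s ∈ I, β (φ s) = Γ s (r s)) ∧
    (∀ s ∈ I, ∃ c : ℝ, F'.N (φ s) = c • F.N s) ∧
    ¬ ∃ z : G, ∀ s ∈ I, β (φ s) = α s * z

end BertrandLie

/-! In dimension three an invariant bracket is a multiple of the cross product: [T,N] = cB, and c =
2τ_G is constant along the curve. Hence in a left-invariant frame the term ½[T,·] only shifts the
torsion, and the Frenet equations become Euclidean ones in 𝔤 with torsion σ = τ − τ_G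
(`IsFrenetCurve.isFrenetSystem`). The unit tangent of the indicatrix is N, so the question is
whether N makes a constant angle with a fixed vector. Along a Bertrand pair the normals agree up to
a constant factor, so the same question may be asked of the mate.

For a Frenet system the normal has this property iff κ²(σ/κ)'/(κ²+σ²)^(3/2) is constant. The mate
moreover satisfies a linear relation aκ + bσ = d (`bertrand_linear_relation`). Since its curvature
is not constant, b ≠ 0 and σ = μ + lam κ; since it is not a helix, μ ≠ 0. Then κ²(σ/κ)' = −μκ', the
criterion says that κ'/(κ²+σ²)^(3/2) is constant, and differentiating gives the stated equation up
to the factor κ (`intrinsic_of_slant`, `slant_of_intrinsic`).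

The linear relation comes from the variation field X of the normal lines. By the Maurer–Cartan
equation X' = N' + [X,N] along such a line (prime on N: derivative along the curve), which is solved
in the plane of T and B by sines and cosines of ct. Comparing X with the velocity of the mate shows
that the distance r is constant and gives two scalar equations; the mate's Frenet equations give two
more. Eliminating κ, σ and φ' leaves the relation, whose coefficients a and b both vanish only for a
trivial mate. -/

open Filter Topology

/-! ### The Maurer–Cartan equation in coordinates. -/

/-- The Maurer–Cartan equation in a chart: if the partial derivatives of `γ` are `L (γ q) (X q)` and
`L (γ q) (Y q)`, then the curl of `(X, Y)` is the torsion of the frame `L`. -/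
theorem maurerCartan_chart {E : Type*} [NormedAddCommGroup E] [NormedSpace ℝ E] [CompleteSpace E]
    {L : E → E →L[ℝ] E} {γ : ℝ × ℝ → E} {X Y : ℝ × ℝ → E} {p : ℝ × ℝ}
    (hL : DifferentiableAt ℝ L (γ p)) (hinv : (L (γ p)).IsInvertible)
    (hγ : ContDiffAt ℝ 2 γ p)
    (hX : ∀ᶠ q in 𝓝 p, fderiv ℝ γ q (1, 0) = L (γ q) (X q))
    (hY : ∀ᶠ q in 𝓝 p, fderiv ℝ γ q (0, 1) = L (γ q) (Y q)) :
    DifferentiableAt ℝ X p ∧ DifferentiableAt ℝ Y p ∧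
      L (γ p) (fderiv ℝ X p (0, 1) - fderiv ℝ Y p (1, 0)) =
        fderiv ℝ L (γ p) (L (γ p) (X p)) (Y p) - fderiv ℝ L (γ p) (L (γ p) (Y p)) (X p) := by
  have hγ1 : DifferentiableAt ℝ γ p := hγ.differentiableAt (by norm_num)
  have hdγ : DifferentiableAt ℝ (fderiv ℝ γ) p :=
    (hγ.fderiv_right (m := 1) (by norm_num)).differentiableAt (by norm_num)
  have hLγ : DifferentiableAt ℝ (fun q => L (γ q)) p := hL.comp p hγ1
  have hLinv : ∀ᶠ q in 𝓝 p, (L (γ q)).IsInvertible := by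
    obtain ⟨e, he⟩ := hinv
    have := e.nhds
    rw [he] at this
    filter_upwards [hLγ.continuousAt.eventually this] with q hq
    obtain ⟨e', he'⟩ := hq
    exact ⟨e', he'⟩
  -- No regularity of X and Y is assumed: inverting the frame writes them as smooth expressions in γ
  -- and its first derivatives. The two mixed second derivatives of γ are then compared by symmetry.
  have key : ∀ (Z : ℝ × ℝ → E) (w : ℝ × ℝ),
      (∀ᶠ q in 𝓝 p, fderiv ℝ γ q w = L (γ q) (Z q)) → DifferentiableAt ℝ Z p ∧
        ∀ u, fderiv ℝ (fderiv ℝ γ) p u w =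
          L (γ p) (fderiv ℝ Z p u) + fderiv ℝ L (γ p) (fderiv ℝ γ p u) (Z p) := by
    intro Z w hZ
    have hZd : DifferentiableAt ℝ Z p := by
      have h1 : Z =ᶠ[𝓝 p] fun q => (L (γ q)).inverse (fderiv ℝ γ q w) := by
        filter_upwards [hZ, hLinv] with q hq hq'
        rw [hq, eq_comm, hq'.inverse_apply_eq]
      refine DifferentiableAt.congr_of_eventuallyEq ?_ h1
      refine DifferentiableAt.clm_apply ?_ (hdγ.clm_apply (differentiableAt_const w))
      exact ((hinv.contDiffAt_map_inverse (n := 1)).differentiableAt (by norm_num)).comp p hLγ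
    refine ⟨hZd, fun u => ?_⟩
    have h2 := (hdγ.hasFDerivAt.clm_apply (hasFDerivAt_const w p)).congr_of_eventuallyEq
      (hZ.mono fun q hq => hq.symm)
    have h3 := (hL.hasFDerivAt.comp p hγ1.hasFDerivAt).clm_apply hZd.hasFDerivAt
    have h4 := DFunLike.congr_fun (h2.unique h3) u
    simpa using h4
  obtain ⟨hXd, hX'⟩ := key X _ hX
  obtain ⟨hYd, hY'⟩ := key Y _ hY
  refine ⟨hXd, hYd, ?_⟩
  have hs : IsSymmSndFDerivAt ℝ γ p := hγ.isSymmSndFDerivAt (by simp)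
  have h1 := hX' (0, 1)
  have h2 := hY' (1, 0)
  rw [hs.eq, h2, hX.self_of_nhds, hY.self_of_nhds] at h1
  rw [map_sub, sub_eq_sub_iff_add_eq_add]
  rw [← h1]; abel

/-- A family of continuous linear maps on a finite-dimensional space is differentiable if all its
applications are. -/
theorem DifferentiableAt.of_clm_apply {D E F : Type*} [NormedAddCommGroup D] [NormedSpace ℝ D]
    [NormedAddCommGroup E] [NormedSpace ℝ E] [NormedAddCommGroup F] [NormedSpace ℝ F]
    [FiniteDimensional ℝ E] {f : D → E →L[ℝ] F} {x : D}
    (h : ∀ v, DifferentiableAt ℝ (fun y => f y v) x) : DifferentiableAt ℝ f x := by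
  let d := Module.finrank ℝ E
  have hd : d = Module.finrank ℝ (Fin d → ℝ) := (Module.finrank_fin_fun ℝ).symm
  let e₁ := ContinuousLinearEquiv.ofFinrankEq hd
  let e₂ := (e₁.arrowCongr (1 : F ≃L[ℝ] F)).trans (ContinuousLinearEquiv.piRing (Fin d))
  rw [← Function.id_comp f, ← e₂.symm_comp_self]
  exact e₂.symm.differentiable.differentiableAt.comp x
    (differentiableAt_pi.mpr fun i => h _)

/-! ### Velocities of curves in the left-invariant frame. -/

noncomputable section LeftDeriv

variable {E : Type*} [NormedAddCommGroup E] [NormedSpace ℝ E]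
  {G : Type*} [TopologicalSpace G] [ChartedSpace E G] [Group G]

/-- The differential at `b` of the left translation by `a`. -/
def leftDiff (a b : G) : E →L[ℝ] E := mfderiv 𝓘(ℝ, E) 𝓘(ℝ, E) (a * ·) b

/-- The linear map `ℝ → E` with value `v` at `1`. -/
def velocityMap (v : E) : ℝ →L[ℝ] E := (1 : ℝ →L[ℝ] ℝ).smulRight v

/-- The curve `γ` has velocity `v` at `s`, written in the left-invariant frame. -/
def HasLeftDerivAt (γ : ℝ → G) (v : E) (s : ℝ) : Prop :=
  HasMFDerivAt 𝓘(ℝ, ℝ) 𝓘(ℝ, E) γ s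
    (velocityMap (E := E) (leftDiff (γ s) 1 v))

variable (E G) in
/-- The left-invariant frame, read in the preferred chart around `1`. -/
def leftFrameInChart (x : E) : E →L[ℝ] E :=
  ContinuousLinearMap.comp (M₁ := E) (M₂ := E) (M₃ := E)
  (mfderivWithin 𝓘(ℝ, E) 𝓘(ℝ, E) (extChartAt 𝓘(ℝ, E) (1 : G)).symm (Set.range 𝓘(ℝ, E)) x).inverse
    (leftDiff ((extChartAt 𝓘(ℝ, E) (1 : G)).symm x) 1)

/-- The bracket of the Lie algebra of `G`, as an operation on the model space. -/
def algBracket (G : Type*) [TopologicalSpace G] [ChartedSpace E G] [Group G] (v w : E) : E :=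
  Bracket.bracket (L := GroupLieAlgebra 𝓘(ℝ, E) G) (M := GroupLieAlgebra 𝓘(ℝ, E) G) v w

theorem leftDiff_one (b : G) : leftDiff (E := E) 1 b = ContinuousLinearMap.id ℝ E := by
  have : ((1 : G) * ·) = id := by ext; simp
  unfold leftDiff
  rw [this]
  exact mfderiv_id

theorem leftFrameInChart_one [IsManifold 𝓘(ℝ, E) 1 G] : leftFrameInChart E G (extChartAt 𝓘(ℝ, E) (1 : G) 1) = ContinuousLinearMap.id ℝ E := by
  unfold leftFrameInChart
  rw [mfderivWithin_range_extChartAt_symm, extChartAt_to_inv, leftDiff_one]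
  exact ContinuousLinearMap.inverse_id (R := ℝ) (M := E)

variable [LieGroup 𝓘(ℝ, E) ∞ G]

theorem contDiffAt_leftFrameInChart_apply [CompleteSpace E] (v : E) :
    ContDiffAt ℝ 1 (fun x => leftFrameInChart E G x v) (extChartAt 𝓘(ℝ, E) (1 : G) 1) := by
  have : LieGroup 𝓘(ℝ, E) (minSmoothness ℝ 3) G := by
    rw [minSmoothness_of_isRCLikeNormedField]; infer_instance
  have h := (contMDiffAt_mulInvariantVectorField (I := 𝓘(ℝ, E)) (G := G) v (g := 1)).of_le
    (m := 1) (by rw [minSmoothness_of_isRCLikeNormedField]; norm_num)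
  have h2 := VectorField.contMDiffWithinAt_mpullbackWithin_extChartAt_symm (n := 2) (s := Set.univ)
    h.contMDiffWithinAt uniqueMDiffOn_univ (Set.mem_univ _) (by norm_num)
  have h3 := contMDiffWithinAt_vectorSpace_iff_contDiffWithinAt.1 h2
  refine ContDiffWithinAt.contDiffAt (s := (extChartAt 𝓘(ℝ, E) (1 : G)).target) ?_
    (extChartAt_target_mem_nhds _)
  simp only [Set.preimage_univ, Set.inter_univ] at h3
  exact h3

/-- The manifold bracket at 1 is computed in the preferred chart at 1, whose differential there is
the identity, so nothing is left to transport. -/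
theorem algBracket_eq_lieBracket (v w : E) : algBracket G v w =
   VectorField.lieBracket ℝ (fun x => leftFrameInChart E G x v) (fun x => leftFrameInChart E G x w)
    (extChartAt 𝓘(ℝ, E) (1 : G) 1) := by
  change VectorField.mlieBracket 𝓘(ℝ, E) _ _ (1 : G) = _
  rw [← VectorField.mlieBracketWithin_univ, VectorField.mlieBracketWithin_apply, mfderiv_extChartAt_self]
  refine (DFunLike.congr_fun (ContinuousLinearMap.inverse_id (R := ℝ) (M := E)) _).trans ?_
  simp only [Set.preimage_univ, Set.univ_inter, modelWithCornersSelf_coe, Set.range_id]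
  rw [← VectorField.lieBracketWithin_univ]
  simp only [leftFrameInChart, modelWithCornersSelf_coe, Set.range_id]
  rfl

theorem mdifferentiableAt_leftTranslation (a b : G) : MDifferentiableAt 𝓘(ℝ, E) 𝓘(ℝ, E) (a * ·) b :=
  (contMDiff_mul_left (n := ∞)).mdifferentiableAt (by simp)

theorem leftDiff_mul (a b c : G) :
   (leftDiff (E := E) (a * b) c) = (leftDiff a (b * c)).comp (leftDiff b c) := by
  unfold leftDiff
  have : (a * b * ·) = (a * ·) ∘ (b * ·) := by ext; simp [mul_assoc]
  rw [this, mfderiv_comp (I' := 𝓘(ℝ, E)) c (mdifferentiableAt_leftTranslation a (b * c))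
    (mdifferentiableAt_leftTranslation b c)]
  rfl

theorem hasMFDerivAt_mul_left (a b : G) :
    HasMFDerivAt 𝓘(ℝ, E) 𝓘(ℝ, E) (a * ·) b (leftDiff (E := E) a b) :=
  (mdifferentiableAt_leftTranslation a b).hasMFDerivAt

theorem leftDiff_injective (a b : G) : Function.Injective (leftDiff (E := E) a b) := by
  have h := leftDiff_mul (E := E) a⁻¹ a b
  rw [inv_mul_cancel, leftDiff_one] at h
  intro x y hxy
  have := DFunLike.congr_fun h
  simp only [ContinuousLinearMap.id_apply, ContinuousLinearMap.comp_apply] at this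
  rw [this x, this y, hxy]

theorem leftDiff_surjective (a b : G) : Function.Surjective (leftDiff (E := E) a b) := by
  have h := leftDiff_mul (E := E) a a⁻¹ (a * b)
  rw [mul_inv_cancel, leftDiff_one, inv_mul_cancel_left] at h
  intro x
  exact ⟨_, (DFunLike.congr_fun h x).symm⟩

omit [LieGroup 𝓘(ℝ, E) ∞ G] in
theorem HasLeftDerivAt.comp {γ : ℝ → G} {v : E} {φ : ℝ → ℝ} {φ' s : ℝ} (h : HasLeftDerivAt γ v (φ s))
    (hφ : HasDerivAt φ φ' s) : HasLeftDerivAt (γ ∘ φ) (φ' • v) s := by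
  refine (HasMFDerivAt.comp s h hφ.hasFDerivAt.hasMFDerivAt).congr_mfderiv ?_
  refine ContinuousLinearMap.ext fun (x : ℝ) => ?_
  change (x * φ') • leftDiff (γ (φ s)) 1 v = x • leftDiff (γ (φ s)) 1 (φ' • v)
  rw [map_smul, smul_smul]

theorem HasLeftDerivAt.const_mul {γ : ℝ → G} {v : E} {s : ℝ} (a : G) (h : HasLeftDerivAt γ v s) :
    HasLeftDerivAt (fun t => a * γ t) v s := by
  refine ((hasMFDerivAt_mul_left a (γ s)).comp s h).congr_mfderiv ?_
  refine ContinuousLinearMap.ext fun (x : ℝ) => ?_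
  change leftDiff a (γ s) (x • leftDiff (γ s) 1 v) = x • leftDiff (a * γ s) 1 v
  rw [map_smul, leftDiff_mul, mul_one]; rfl

theorem HasLeftDerivAt.unique {γ : ℝ → G} {v w : E} {s : ℝ} (h : HasLeftDerivAt γ v s)
    (h' : HasLeftDerivAt γ w s) : v = w := by
  have := hasMFDerivAt_unique h h'
  have := DFunLike.congr_fun this (1 : ℝ)
  refine leftDiff_injective (γ s) 1 ?_
  change (1 : ℝ) • leftDiff (γ s) 1 v = (1 : ℝ) • leftDiff (γ s) 1 w at this
  simpa only [one_smul] using this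

theorem MDifferentiableAt.exists_hasLeftDerivAt {γ : ℝ → G} {s : ℝ}
    (h : MDifferentiableAt 𝓘(ℝ, ℝ) 𝓘(ℝ, E) γ s) : ∃ v : E, HasLeftDerivAt γ v s := by
  obtain ⟨v, hv⟩ := leftDiff_surjective (E := E) (γ s) 1 (mfderiv 𝓘(ℝ, ℝ) 𝓘(ℝ, E) γ s (1 : ℝ))
  refine ⟨v, h.hasMFDerivAt.congr_mfderiv ?_⟩
  rw [hv]
  refine ContinuousLinearMap.ext fun (x : ℝ) => ?_
  let φ : ℝ →L[ℝ] E := mfderiv 𝓘(ℝ, ℝ) 𝓘(ℝ, E) γ s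
  change φ x = x • φ 1
  rw [← map_smul, smul_eq_mul, mul_one]

/-- In a chart around γ x the curve has zero derivative, so γ is locally constant; preconnectedness
globalizes this. -/
theorem eq_of_hasLeftDerivAt_zero {γ : ℝ → G} {I : Set ℝ} (hI : IsOpen I) (hc : IsPreconnected I)
   (h : ∀ s ∈ I, HasLeftDerivAt γ (0 : E) s) {s t : ℝ} (hs : s ∈ I) (ht : t ∈ I) : γ s = γ t := by
  refine hc.induction₂ (fun x y => γ x = γ y) ?_ (fun x y z _ _ _ => Eq.trans)
    (fun x y _ _ => Eq.symm) hs ht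
  intro x hx
  refine nhdsWithin_le_nhds ?_
  let e := extChartAt 𝓘(ℝ, E) (γ x)
  have hsrc : ∀ᶠ y in 𝓝 x, γ y ∈ e.source :=
    (h x hx).continuousAt.eventually (extChartAt_source_mem_nhds (I := 𝓘(ℝ, E)) (γ x))
  obtain ⟨ε, hε, hball⟩ := Metric.eventually_nhds_iff_ball.1 (hsrc.and (hI.mem_nhds hx))
  filter_upwards [Metric.ball_mem_nhds x hε] with y hy
  have hd : ∀ z ∈ Metric.ball x ε, HasFDerivAt (e ∘ γ) (0 : ℝ →L[ℝ] E) z := by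
    intro z hz
    obtain ⟨h1, h2⟩ := hball z hz
    have h3 := (mdifferentiableAt_extChartAt (I := 𝓘(ℝ, E)) (x := γ x) (y := γ z)
      (by rwa [← extChartAt_source (I := 𝓘(ℝ, E))])).hasMFDerivAt.comp z (h z h2)
    refine (h3.congr_mfderiv ?_).hasFDerivAt
    refine ContinuousLinearMap.ext fun (x : ℝ) => ?_
    have : x • leftDiff (E := E) (γ z) 1 0 = 0 := by rw [map_zero, smul_zero]
    exact (congrArg (mfderiv 𝓘(ℝ, E) 𝓘(ℝ, E) e (γ z)) this).trans
      ((mfderiv 𝓘(ℝ, E) 𝓘(ℝ, E) e (γ z)).map_zero)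
  have h4 : (e ∘ γ) x = (e ∘ γ) y :=
    Metric.isOpen_ball.is_const_of_fderiv_eq_zero (convex_ball x ε).isPreconnected
      (fun z hz => (hd z hz).differentiableAt.differentiableWithinAt) (fun z hz => (hd z hz).fderiv)
      (Metric.mem_ball_self hε) hy
  exact e.injOn (hball x (Metric.mem_ball_self hε)).1 (hball y hy).1 h4

end LeftDeriv

/-! ### The Maurer–Cartan equation on the group and ad-invariance of the metric. -/

noncomputable section MaurerCartan

variable {E : Type*} [NormedAddCommGroup E] [NormedSpace ℝ E]
  {G : Type*} [TopologicalSpace G] [ChartedSpace E G] [Group G] [LieGroup 𝓘(ℝ, E) ∞ G]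

/-- The differential at `a` of the preferred chart around `1`. -/
def chartDiff (a : G) : E →L[ℝ] E := mfderiv 𝓘(ℝ, E) 𝓘(ℝ, E) (extChartAt 𝓘(ℝ, E) (1 : G)) a

theorem leftFrameInChart_extChartAt {a : G} (ha : a ∈ (extChartAt 𝓘(ℝ, E) (1 : G)).source) (v : E) :
    leftFrameInChart E G (extChartAt 𝓘(ℝ, E) (1 : G) a) v =
      chartDiff a (leftDiff a 1 v) := by
  have h1 := mfderivWithin_extChartAt_symm_comp_mfderiv_extChartAt' ha
  have h2 := mfderiv_extChartAt_comp_mfderivWithin_extChartAt_symm' ha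
  unfold leftFrameInChart
  have h3 := ContinuousLinearMap.inverse_eq (M := E) (M₂ := E) (R := ℝ) h1 h2
  rw [(extChartAt 𝓘(ℝ, E) (1 : G)).left_inv ha]
  exact DFunLike.congr_fun h3 (leftDiff a 1 v)

theorem HasLeftDerivAt.hasDerivAt_extChartAt {γ : ℝ → G} {v : E} {s : ℝ} (h : HasLeftDerivAt γ v s)
    (hs : γ s ∈ (extChartAt 𝓘(ℝ, E) (1 : G)).source) :
    HasDerivAt (fun t => extChartAt 𝓘(ℝ, E) (1 : G) (γ t))
      (leftFrameInChart E G (extChartAt 𝓘(ℝ, E) (1 : G) (γ s)) v) s := by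
  have h3 := (mdifferentiableAt_extChartAt (I := 𝓘(ℝ, E)) (x := (1 : G)) (y := γ s)
      (by rwa [← extChartAt_source (I := 𝓘(ℝ, E))])).hasMFDerivAt.comp s h
  rw [leftFrameInChart_extChartAt hs, hasDerivAt_iff_hasFDerivAt]
  refine (h3.congr_mfderiv ?_).hasFDerivAt
  refine ContinuousLinearMap.ext fun (x : ℝ) => ?_
  change chartDiff (γ s) (x • leftDiff (γ s) 1 v) = x • chartDiff (γ s) (leftDiff (γ s) 1 v)
  rw [map_smul]

/-- The Maurer–Cartan equation for a map from the plane to a Lie group. -/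
theorem maurerCartan [FiniteDimensional ℝ E] {Γ : ℝ × ℝ → G} {X Y : ℝ × ℝ → E} {p : ℝ × ℝ}
    (hΓ : ContMDiffAt 𝓘(ℝ, ℝ × ℝ) 𝓘(ℝ, E) 2 Γ p)
    (hX : ∀ᶠ q in 𝓝 p, HasLeftDerivAt (fun s => Γ (s, q.2)) (X q) q.1)
    (hY : ∀ᶠ q in 𝓝 p, HasLeftDerivAt (fun t => Γ (q.1, t)) (Y q) q.2) :
    DifferentiableAt ℝ X p ∧ DifferentiableAt ℝ Y p ∧
      fderiv ℝ X p (0, 1) - fderiv ℝ Y p (1, 0) = algBracket G (X p) (Y p) := by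
  have : CompleteSpace E := FiniteDimensional.complete ℝ E
  let e := extChartAt 𝓘(ℝ, E) (1 : G)
  -- Left translation by (Γ p)⁻¹ leaves the left-invariant velocities unchanged and moves the base
  -- point to 1. There the frame is the identity, and its torsion is the bracket of 𝔤.
  let γ : ℝ × ℝ → E := fun q => e ((Γ p)⁻¹ * Γ q)
  have hγp : γ p = e 1 := by simp [γ]
  have hΓ' : ContMDiffAt 𝓘(ℝ, ℝ × ℝ) 𝓘(ℝ, E) 2 (fun q => (Γ p)⁻¹ * Γ q) p :=
    (contMDiff_mul_left (n := 2) (a := (Γ p)⁻¹)).contMDiffAt.comp p hΓ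
  have hγ : ContDiffAt ℝ 2 γ p :=
    ((contMDiffAt_extChartAt (I := 𝓘(ℝ, E)) (n := 2) (x := (1 : G))).comp_of_eq hΓ'
      (by simp)).contDiffAt
  have hγd : ∀ᶠ q in 𝓝 p, DifferentiableAt ℝ γ q :=
    (hγ.eventually (by simp)).mono fun q hq => hq.differentiableAt (by norm_num)
  have hsrc : ∀ᶠ q in 𝓝 p, (Γ p)⁻¹ * Γ q ∈ e.source := by
    refine hΓ'.continuousAt.eventually ?_
    simp only [inv_mul_cancel]
    exact extChartAt_source_mem_nhds (I := 𝓘(ℝ, E)) (1 : G)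
  have hL : DifferentiableAt ℝ (leftFrameInChart E G) (γ p) := by
    rw [hγp]
    exact .of_clm_apply fun v => (contDiffAt_leftFrameInChart_apply v).differentiableAt (by norm_num)
  have hL1 : leftFrameInChart E G (γ p) = ContinuousLinearMap.id ℝ E := by
    rw [hγp, leftFrameInChart_one]
  obtain ⟨h1, h2, h3⟩ := maurerCartan_chart (X := X) (Y := Y) hL
    (by rw [hL1]; exact ⟨ContinuousLinearEquiv.refl ℝ E, rfl⟩) hγ
    (by
      filter_upwards [hγd, hsrc, hX] with q hq hqs hqX
      refine HasDerivAt.unique ?_ ((hqX.const_mul (Γ p)⁻¹).hasDerivAt_extChartAt hqs)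
      exact hq.hasFDerivAt.comp_hasDerivAt q.1
        ((hasDerivAt_id q.1).prodMk (hasDerivAt_const q.1 q.2)))
    (by
      filter_upwards [hγd, hsrc, hY] with q hq hqs hqY
      refine HasDerivAt.unique ?_ ((hqY.const_mul (Γ p)⁻¹).hasDerivAt_extChartAt hqs)
      exact hq.hasFDerivAt.comp_hasDerivAt q.2
        ((hasDerivAt_const q.2 q.1).prodMk (hasDerivAt_id q.2)))
  refine ⟨h1, h2, ?_⟩
  rw [hL1] at h3
  have hv : ∀ v w : E, fderiv ℝ (fun x => leftFrameInChart E G x v) (e 1) w =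
      fderiv ℝ (leftFrameInChart E G) (e 1) w v := by
    intro v w
    rw [hγp] at hL
    rw [fderiv_clm_apply hL (differentiableAt_const v)]
    simp
  rw [algBracket_eq_lieBracket, VectorField.lieBracket_eq]
  change _ = fderiv ℝ (fun x => leftFrameInChart E G x (Y p)) (e 1) (leftFrameInChart E G (e 1) (X p)) -
    fderiv ℝ (fun x => leftFrameInChart E G x (X p)) (e 1) (leftFrameInChart E G (e 1) (Y p))
  rw [hv, hv, leftFrameInChart_one]
  rw [hγp] at h3
  exact h3

/-- The metric at `x`, as a bilinear form on the model space. -/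
def metricForm (g : LieMetric E G) (x : G) : E →L[ℝ] E →L[ℝ] ℝ := g.inner x

/-- The differential at `b` of the right translation by `a`. -/
def rightDiff (a b : G) : E →L[ℝ] E := mfderiv 𝓘(ℝ, E) 𝓘(ℝ, E) (· * a) b

theorem hasMFDerivAt_mul_right (a b : G) :
    HasMFDerivAt 𝓘(ℝ, E) 𝓘(ℝ, E) (· * a) b (rightDiff (E := E) a b) :=
  ((contMDiff_mul_right (n := ∞)).mdifferentiableAt (by simp)).hasMFDerivAt

theorem IsBiInvariant.metricForm_leftDiff {g : LieMetric E G} (hg : IsBiInvariant g) (a : G)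
    (v w : E) : metricForm g a (leftDiff a 1 v) (leftDiff a 1 w) = metricForm g 1 v w := by
  have := hg.left a 1 v w
  change metricForm g (a * 1) (leftDiff a 1 v) (leftDiff a 1 w) = metricForm g 1 v w at this
  rwa [mul_one] at this

theorem IsBiInvariant.metricForm_rightDiff {g : LieMetric E G} (hg : IsBiInvariant g) (a : G)
    (v w : E) : metricForm g a (rightDiff a 1 v) (rightDiff a 1 w) = metricForm g 1 v w := by
  have := hg.right a 1 v w
  change metricForm g (1 * a) (rightDiff a 1 v) (rightDiff a 1 w) = metricForm g 1 v w at this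
  rwa [one_mul] at this

theorem metricForm_symm (g : LieMetric E G) (x : G) (v w : E) :
    metricForm g x v w = metricForm g x w v := g.symm x v w

/-- The velocity field is merely chosen pointwise; its differentiability is supplied afterwards by
`maurerCartan`. -/
theorem exists_eventually_hasLeftDerivAt {M : Type*} [TopologicalSpace M] {Γ : M → ℝ → G} {f : M → ℝ}
    {l : Filter M} (h : ∀ᶠ q in l, MDifferentiableAt 𝓘(ℝ, ℝ) 𝓘(ℝ, E) (Γ q) (f q)) :
    ∃ X : M → E, ∀ᶠ q in l, HasLeftDerivAt (Γ q) (X q) (f q) := by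
  classical
  refine ⟨fun q => if hq : ∃ v : E, HasLeftDerivAt (Γ q) v (f q) then hq.choose else 0, ?_⟩
  filter_upwards [h] with q hq
  have := hq.exists_hasLeftDerivAt
  rw [dif_pos this]
  exact this.choose_spec

theorem exists_curve_through_one [FiniteDimensional ℝ E] (v : E) : ∃ η : ℝ → G, η 0 = 1 ∧
    ContMDiffAt 𝓘(ℝ, ℝ) 𝓘(ℝ, E) 2 η 0 ∧ HasLeftDerivAt η v 0 := by
  let e := extChartAt 𝓘(ℝ, E) (1 : G)
  let η : ℝ → G := fun s => e.symm (e 1 + s • v)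
  have h0 : η 0 = 1 := by simp [η, e]
  have hs : ContMDiffAt 𝓘(ℝ, ℝ) 𝓘(ℝ, E) 2 η 0 := by
    have h1 : ContMDiffAt 𝓘(ℝ, E) 𝓘(ℝ, E) 2 e.symm (e 1) :=
      (contMDiffOn_extChartAt_symm (n := 2) (1 : G)).contMDiffAt
        (extChartAt_target_mem_nhds (1 : G))
    refine h1.comp_of_eq ?_ (by simp)
    exact (contDiff_const.add (contDiff_id.smul contDiff_const)).contDiffAt.contMDiffAt
  obtain ⟨w, hw⟩ := (hs.mdifferentiableAt (by norm_num)).exists_hasLeftDerivAt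
  have h2 := hw.hasDerivAt_extChartAt (by rw [h0]; exact mem_extChartAt_source _)
  rw [h0, leftFrameInChart_one] at h2
  have h3 : HasDerivAt (fun t : ℝ => e 1 + t • v) v 0 := by
    simpa using ((hasDerivAt_id (0 : ℝ)).smul_const v).const_add (e 1)
  have h4 : (fun t => e (η t)) =ᶠ[𝓝 0] fun t : ℝ => e 1 + t • v := by
    have : ∀ᶠ t in 𝓝 (0 : ℝ), e 1 + t • v ∈ e.target := by
      refine h3.continuousAt.eventually ?_
      simp only [zero_smul, add_zero]
      exact extChartAt_target_mem_nhds (1 : G)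
    filter_upwards [this] with t ht
    exact e.right_inv ht
  have h5 : w = v := (h3.congr_of_eventuallyEq h4).unique h2 |>.symm
  exact ⟨η, h0, hs, h5 ▸ hw⟩

/-- The scalar product of a bi-invariant metric is `ad`-invariant. -/
theorem metricForm_algBracket_self [FiniteDimensional ℝ E] {g : LieMetric E G}
    (hg : IsBiInvariant g) (v w : E) : metricForm g 1 v (algBracket G v w) = 0 := by
  obtain ⟨η, hη0, hη, hηv⟩ := exists_curve_through_one (G := G) v
  obtain ⟨a, ha0, ha, haw⟩ := exists_curve_through_one (G := G) w
  -- In the family η(s)a(t) the t-velocity does not depend on s, while the s-velocity at (0,t) is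
  -- Ad(a(t)⁻¹)v. By Maurer–Cartan its derivative at t = 0 is [v,w], and by bi-invariance its length
  -- is constant; differentiating the squared length gives the claim.
  have hΓ : ContMDiffAt 𝓘(ℝ, ℝ × ℝ) 𝓘(ℝ, E) 2 (fun q : ℝ × ℝ => η q.1 * a q.2) (0, 0) := by
    have h1 : ContMDiffAt 𝓘(ℝ, ℝ × ℝ) 𝓘(ℝ, E) 2 (fun q : ℝ × ℝ => η q.1) (0, 0) :=
      ContMDiffAt.comp (0, 0) (f := Prod.fst) (I' := 𝓘(ℝ, ℝ)) hη contDiff_fst.contDiffAt.contMDiffAt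
    have h2 : ContMDiffAt 𝓘(ℝ, ℝ × ℝ) 𝓘(ℝ, E) 2 (fun q : ℝ × ℝ => a q.2) (0, 0) :=
      ContMDiffAt.comp (0, 0) (f := Prod.snd) (I' := 𝓘(ℝ, ℝ)) ha contDiff_snd.contDiffAt.contMDiffAt
    exact h1.mul h2
  have ha' : ∀ᶠ t in 𝓝 (0 : ℝ), MDifferentiableAt 𝓘(ℝ, ℝ) 𝓘(ℝ, E) a t :=
    ((contMDiffAt_iff_contMDiffAt_nhds (by simp)).1 ha).mono fun t ht => ht.mdifferentiableAt (by norm_num)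
  have hη' : ∀ᶠ t in 𝓝 (0 : ℝ), MDifferentiableAt 𝓘(ℝ, ℝ) 𝓘(ℝ, E) η t :=
    ((contMDiffAt_iff_contMDiffAt_nhds (by simp)).1 hη).mono fun t ht => ht.mdifferentiableAt (by norm_num)
  obtain ⟨A, hA⟩ := exists_eventually_hasLeftDerivAt (Γ := fun _ : ℝ => a) (f := fun t => t) ha'
  have hfst : ∀ᶠ q in 𝓝 ((0 : ℝ), (0 : ℝ)), MDifferentiableAt 𝓘(ℝ, ℝ) 𝓘(ℝ, E)
      (fun s => η s * a q.2) q.1 := by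
    filter_upwards [(continuous_fst.tendsto ((0 : ℝ), (0 : ℝ))).eventually hη'] with q hq
    exact (hasMFDerivAt_mul_right (a q.2) (η q.1)).mdifferentiableAt.comp q.1 hq
  obtain ⟨X, hX⟩ := exists_eventually_hasLeftDerivAt
    (Γ := fun (q : ℝ × ℝ) s => η s * a q.2) (f := Prod.fst) hfst
  obtain ⟨hXd, hYd, hMC⟩ := maurerCartan (Y := fun q => A q.2) hΓ hX (by
    filter_upwards [(continuous_snd.tendsto ((0 : ℝ), (0 : ℝ))).eventually hA] with q hq
    exact hq.const_mul (η q.1))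
  have hA0 : A 0 = w := hA.self_of_nhds.unique haw
  have hX0 : X (0, 0) = v := by
    refine (hX.self_of_nhds).unique ?_
    simpa [ha0] using hηv
  have hYs : fderiv ℝ (fun q : ℝ × ℝ => A q.2) (0, 0) (1, 0) = 0 :=
    (hYd.hasFDerivAt.comp_hasDerivAt (f := fun s : ℝ => (s, (0 : ℝ))) (0 : ℝ)
      ((hasDerivAt_id (0 : ℝ)).prodMk (hasDerivAt_const (0 : ℝ) (0 : ℝ)))).unique
      (hasDerivAt_const (0 : ℝ) (A 0))
  have hXt : HasDerivAt (fun t => X (0, t)) (algBracket G v w) 0 := by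
    have h1 := hXd.hasFDerivAt.comp_hasDerivAt (0 : ℝ)
      ((hasDerivAt_const (0 : ℝ) (0 : ℝ)).prodMk (hasDerivAt_id (0 : ℝ)))
    rw [hYs, sub_zero, hX0, hA0] at hMC
    rw [← hMC]
    exact h1
  have hnorm : ∀ᶠ t in 𝓝 (0 : ℝ),
      metricForm g 1 (X (0, t)) (X (0, t)) = metricForm g 1 v v := by
    have htend : Tendsto (fun t : ℝ => ((0 : ℝ), t)) (𝓝 0) (𝓝 ((0 : ℝ), (0 : ℝ))) :=
      (by fun_prop : Continuous fun t : ℝ => ((0 : ℝ), t)).tendsto' _ _ rfl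
    filter_upwards [htend.eventually hX] with t ht
    have h1 := hasMFDerivAt_unique ht ((hasMFDerivAt_mul_right (a t) (η 0)).comp (0 : ℝ) hηv)
    have h2 : (1 : ℝ) • leftDiff (η 0 * a t) 1 (X (0, t)) =
        rightDiff (a t) (η 0) ((1 : ℝ) • leftDiff (η 0) 1 v) := DFunLike.congr_fun h1 (1 : ℝ)
    rw [one_smul, one_smul, hη0, one_mul, leftDiff_one] at h2
    rw [← hg.metricForm_leftDiff (a t), h2]
    exact hg.metricForm_rightDiff (a t) v v
  have h1 := ((metricForm g 1).hasFDerivAt.comp_hasDerivAt (0 : ℝ) hXt).clm_apply hXt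
  have h2 := h1.unique ((hasDerivAt_const (0 : ℝ) (metricForm g 1 v v)).congr_of_eventuallyEq hnorm)
  rw [Function.comp_apply, hX0, metricForm_symm g 1 (algBracket G v w) v] at h2
  linarith

end MaurerCartan

/-! ### Euclidean Frenet systems: constant angle of the normal, parallel normals. -/

section Frame
variable {V : Type*} [NormedAddCommGroup V] [NormedSpace ℝ V]

/-- `T`, `N`, `B` are orthonormal for the bilinear form `ip`. -/
structure IsOrthonormalTriple (ip : V →L[ℝ] V →L[ℝ] ℝ) (T N B : V) : Prop where
  TT : ip T T = 1
  NN : ip N N = 1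
  BB : ip B B = 1
  TN : ip T N = 0
  TB : ip T B = 0
  NB : ip N B = 0

theorem IsOrthonormalTriple.eq_sum {ip : V →L[ℝ] V →L[ℝ] ℝ} {T N B : V}
    (h : IsOrthonormalTriple ip T N B) (hsymm : ∀ v w, ip v w = ip w v)
    (hV : Module.finrank ℝ V = 3) (x : V) :
    x = ip x T • T + ip x N • N + ip x B • B := by
  have hli : LinearIndependent ℝ ![T, N, B] := by
    rw [Fintype.linearIndependent_iff]
    intro c hc
    simp only [Fin.sum_univ_three, Matrix.cons_val] at hc
    have h1 := congrArg (ip T) hc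
    have h2 := congrArg (ip N) hc
    have h3 := congrArg (ip B) hc
    simp only [map_add, map_smul, map_zero, smul_eq_mul, h.TT, h.NN, h.BB, h.TN, h.TB, h.NB,
      hsymm N T, hsymm B T, hsymm B N] at h1 h2 h3
    intro i
    fin_cases i <;> simp <;> linarith
  let b := basisOfLinearIndependentOfCardEqFinrank hli (by simp [hV])
  have hx := b.sum_repr x
  simp only [Fin.sum_univ_three, b, coe_basisOfLinearIndependentOfCardEqFinrank,
    Matrix.cons_val] at hx
  set p := (basisOfLinearIndependentOfCardEqFinrank hli (by simp [hV])).repr x 0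
  set q := (basisOfLinearIndependentOfCardEqFinrank hli (by simp [hV])).repr x 1
  set r := (basisOfLinearIndependentOfCardEqFinrank hli (by simp [hV])).repr x 2
  rw [← hx]
  simp [h.TT, h.NN, h.BB, h.TN, h.TB, h.NB, hsymm N T, hsymm B T, hsymm B N]

/-- An orthonormal frame `T`, `N`, `B` on `I` satisfying the Euclidean Frenet equations. -/
structure IsFrenetSystem (ip : V →L[ℝ] V →L[ℝ] ℝ) (I : Set ℝ) (T N B : ℝ → V) (κ σ : ℝ → ℝ) :
    Prop where
  orthonormal : ∀ s ∈ I, IsOrthonormalTriple ip (T s) (N s) (B s)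
  deriv_T : ∀ s ∈ I, HasDerivAt T (κ s • N s) s
  deriv_N : ∀ s ∈ I, HasDerivAt N (-κ s • T s + σ s • B s) s
  deriv_B : ∀ s ∈ I, HasDerivAt B (-σ s • N s) s
  pos : ∀ s ∈ I, 0 < κ s

theorem hasDerivAt_form (ip : V →L[ℝ] V →L[ℝ] ℝ) {f g : ℝ → V} {f' g' : V} {s : ℝ}
    (hf : HasDerivAt f f' s) (hg : HasDerivAt g g' s) :
    HasDerivAt (fun t => ip (f t) (g t)) (ip f' (g s) + ip (f s) g') s :=
  (ip.hasFDerivAt.comp_hasDerivAt s hf).clm_apply hg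

theorem HasDerivAt.eq_of_eqOn {F : Type*} [NormedAddCommGroup F] [NormedSpace ℝ F] {f g : ℝ → F}
    {f' g' : F} {I : Set ℝ} {s : ℝ} (hI : IsOpen I)
    (hs : s ∈ I) (hf : HasDerivAt f f' s) (hg : HasDerivAt g g' s) (h : ∀ t ∈ I, f t = g t) :
    f' = g' :=
  hf.unique (hg.congr_of_eventuallyEq (eventually_of_mem (hI.mem_nhds hs) h))

theorem exists_const_of_hasDerivAt_zero {F : Type*} [NormedAddCommGroup F] [NormedSpace ℝ F]
    {f : ℝ → F} {I : Set ℝ} (hI : IsOpen I) (hc : IsPreconnected I)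
    (h : ∀ s ∈ I, HasDerivAt f 0 s) : ∃ a, ∀ s ∈ I, f s = a :=
  hI.exists_is_const_of_deriv_eq_zero hc
    (fun s hs => (h s hs).differentiableAt.differentiableWithinAt) fun s hs => (h s hs).deriv

namespace IsFrenetSystem

variable {ip : V →L[ℝ] V →L[ℝ] ℝ} {I : Set ℝ} {T N B : ℝ → V} {κ σ κ₁ κ₂ : ℝ → ℝ} {lam μ : ℝ}

/-- If `σ = μ + lam * κ` and the normal makes a constant angle with a fixed vector, then the curvature
satisfies a second order equation. -/
theorem intrinsic_of_slant (F : IsFrenetSystem ip I T N B κ σ) (hsymm : ∀ v w, ip v w = ip w v)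
    (hV : Module.finrank ℝ V = 3) (hI : IsOpen I) (hμ : μ ≠ 0)
    (hσ : ∀ s ∈ I, σ s = μ + lam * κ s)
    (hκ₁ : ∀ s ∈ I, HasDerivAt κ (κ₁ s) s) (hκ₂ : ∀ s ∈ I, HasDerivAt κ₁ (κ₂ s) s)
    {d : V} (hd : d ≠ 0) {k : ℝ} (hk : ∀ s ∈ I, ip (N s) d = k) :
    ∀ s ∈ I, κ₂ s * (κ s ^ 2 + σ s ^ 2) - 3 * κ₁ s ^ 2 * (κ s + lam * σ s) = 0 := by
  have hu : ∀ s ∈ I, HasDerivAt (fun t => ip (T t) d) (κ s * k) s := fun s hs => by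
    simpa [hk s hs] using hasDerivAt_form ip (F.deriv_T s hs) (hasDerivAt_const s d)
  have hv : ∀ s ∈ I, HasDerivAt (fun t => ip (B t) d) (-σ s * k) s := fun s hs => by
    simpa [hk s hs] using hasDerivAt_form ip (F.deriv_B s hs) (hasDerivAt_const s d)
  have hσ' : ∀ s ∈ I, HasDerivAt σ (lam * κ₁ s) s := fun s hs =>
    (((hκ₁ s hs).const_mul lam).const_add μ).congr_of_eventuallyEq
      (eventually_of_mem (hI.mem_nhds hs) hσ)
  -- The constancy of ⟨N,d⟩ is differentiated three times, giving `h1`, `h2` and `h3` in turn.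
  have h1 : ∀ s ∈ I, κ s * ip (T s) d = σ s * ip (B s) d := fun s hs => by
    have := HasDerivAt.eq_of_eqOn hI hs (hasDerivAt_form ip (F.deriv_N s hs) (hasDerivAt_const s d))
      (hasDerivAt_const s k) hk
    simp at this
    linarith
  have h2 : ∀ s ∈ I, k * (κ s ^ 2 + σ s ^ 2) * κ s = -(ip (B s) d * μ * κ₁ s) := fun s hs => by
    have := HasDerivAt.eq_of_eqOn hI hs ((hκ₁ s hs).mul (hu s hs)) ((hσ' s hs).mul (hv s hs)) h1
    have h := h1 s hs
    have h' := hσ s hs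
    linear_combination κ s * this - κ₁ s * h - κ₁ s * ip (B s) d * h'
  intro s hs
  have h3 := HasDerivAt.eq_of_eqOn hI hs
    (((((hκ₁ s hs).pow 2).add ((hσ' s hs).pow 2)).const_mul k).mul (hκ₁ s hs))
    ((((hv s hs).mul_const μ).mul (hκ₂ s hs)).neg) h2
  have h4 := h2 s hs
  have h5 := hσ s hs
  -- If this component vanished, `h2` and `h1` would kill the other two, forcing d = 0.
  have hv0 : ip (B s) d ≠ 0 := by
    intro h0
    have hpos := F.pos s hs
    rw [h0] at h4
    have hk0 : k = 0 := by
      have : κ s ^ 2 + σ s ^ 2 ≠ 0 := by positivity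
      simpa [this, hpos.ne'] using h4
    have hT := h1 s hs
    rw [h0, mul_zero] at hT
    have hT0 : ip (T s) d = 0 := by simpa [hpos.ne'] using hT
    apply hd
    rw [(F.orthonormal s hs).eq_sum hsymm hV d, hsymm d, hsymm d, hsymm d, hT0, hk s hs, hk0, h0]
    simp
  have hpos := F.pos s hs
  simp at h3
  generalize ip (B s) d = v at *
  generalize κ s = a at *
  generalize σ s = b at *
  generalize κ₁ s = a₁ at *
  generalize κ₂ s = a₂ at *
  have hne : v * μ * a ≠ 0 := by positivity
  refine (mul_eq_zero.1 (?_ : (v * μ * a) * _ = 0)).resolve_left hne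
  -- The angle constant k is eliminated between `h3` and `h4`.
  linear_combination (a ^ 2 + b ^ 2) * a * h3
    - (2 * a₁ * (a + lam * b) * a + (a ^ 2 + b ^ 2) * a₁ - b * μ * a₁) * h4
    + v * μ * a₁ ^ 2 * b * h5

/-- The converse of `intrinsic_of_slant`: the axis is `(σ T + κ B) / R - (μ κ' / R ^ 3) N`. -/
theorem slant_of_intrinsic (F : IsFrenetSystem ip I T N B κ σ) (hI : IsOpen I)
    (hc : IsPreconnected I) (hne : I.Nonempty) (hsymm : ∀ v w, ip v w = ip w v)
    (hσ : ∀ s ∈ I, σ s = μ + lam * κ s)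
    (hκ₁ : ∀ s ∈ I, HasDerivAt κ (κ₁ s) s) (hκ₂ : ∀ s ∈ I, HasDerivAt κ₁ (κ₂ s) s)
    (h : ∀ s ∈ I, κ₂ s * (κ s ^ 2 + σ s ^ 2) - 3 * κ₁ s ^ 2 * (κ s + lam * σ s) = 0) :
    ∃ d : V, d ≠ 0 ∧ ∃ k : ℝ, ∀ s ∈ I, ip (N s) d = k := by
  let R : ℝ → ℝ := fun s => √(κ s ^ 2 + σ s ^ 2)
  have hR : ∀ s ∈ I, 0 < R s := fun s hs => by have := F.pos s hs; simp only [R]; positivity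
  have hR2 : ∀ s, R s ^ 2 = κ s ^ 2 + σ s ^ 2 := fun s => Real.sq_sqrt (by positivity)
  have hσ' : ∀ s ∈ I, HasDerivAt σ (lam * κ₁ s) s := fun s hs =>
    (((hκ₁ s hs).const_mul lam).const_add μ).congr_of_eventuallyEq
      (eventually_of_mem (hI.mem_nhds hs) hσ)
  have hRd : ∀ s ∈ I, HasDerivAt R (κ₁ s * (κ s + lam * σ s) / R s) s := fun s hs => by
    have hp := F.pos s hs
    convert (((hκ₁ s hs).pow 2).add ((hσ' s hs).pow 2)).sqrt
      (show κ s ^ 2 + σ s ^ 2 ≠ 0 by positivity) using 1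
    have := (hR s hs).ne'
    simp only [R, Pi.add_apply, Pi.pow_apply] at this ⊢
    field_simp
    norm_num
    ring
  -- The second-order equation is exactly the vanishing of (κ'/R³)'.
  obtain ⟨m, hm⟩ := exists_const_of_hasDerivAt_zero (f := fun s => κ₁ s / R s ^ 3) hI hc
    (fun s hs => by
      have hp := (hR s hs).ne'
      refine ((hκ₂ s hs).div ((hRd s hs).pow 3) (pow_ne_zero 3 hp)).congr_deriv ?_
      have h1 := h s hs
      rw [← hR2 s] at h1
      simp only [Pi.pow_apply]
      field_simp
      norm_num
      linear_combination R s ^ 2 * h1)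
  have hm' : ∀ s ∈ I, κ₁ s = m * R s ^ 3 := fun s hs => by
    have hp := (hR s hs).ne'
    rw [← hm s hs]; field_simp
  obtain ⟨d, hd⟩ := exists_const_of_hasDerivAt_zero
    (f := fun s => (σ s / R s) • T s + (κ s / R s) • B s - (μ * m) • N s) hI hc (fun s hs => by
      have hp := (hR s hs).ne'
      refine (((((hσ' s hs).div (hRd s hs) hp).smul (F.deriv_T s hs)).add
        (((hκ₁ s hs).div (hRd s hs) hp).smul (F.deriv_B s hs))).sub
        ((F.deriv_N s hs).const_smul (μ * m))).congr_deriv ?_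
      have h2 := hR2 s
      have h3 := hm' s hs
      have h4 := hσ s hs
      generalize hRr : R s = r at *
      generalize hκr : κ s = a at *
      generalize hσr : σ s = b at *
      generalize κ₁ s = a₁ at *
      have e1 : (lam * a₁ * r - b * (a₁ * (a + lam * b) / r)) / r ^ 2 + μ * m * a = 0 := by
        rw [h3]
        field_simp
        linear_combination m * lam * h2 - m * a * h4
      have e2 : (a₁ * r - a * (a₁ * (a + lam * b) / r)) / r ^ 2 - μ * m * b = 0 := by
        rw [h3]
        field_simp
        linear_combination m * h2 + m * b * h4
      have : (0 : V) = ((lam * a₁ * r - b * (a₁ * (a + lam * b) / r)) / r ^ 2 + μ * m * a) • T s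
        + ((a₁ * r - a * (a₁ * (a + lam * b) / r)) / r ^ 2 - μ * m * b) • B s := by
        rw [e1, e2]; simp
      rw [eq_comm, this]
      simp only [Pi.div_apply, hRr, hκr, hσr]
      module)
  obtain ⟨s₀, hs₀⟩ := hne
  have hin : ∀ s ∈ I, ip (N s) d = -(μ * m) := fun s hs => by
    have O := F.orthonormal s hs
    rw [← hd s hs]
    simp [hsymm (N s) (T s), O.TN, O.NB, O.NN]
  refine ⟨d, ?_, _, hin⟩
  -- The B-component of the axis is κ/R > 0.
  rintro rfl
  have O := F.orthonormal s₀ hs₀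
  have h1 := congrArg (ip (B s₀)) (hd s₀ hs₀)
  have hp := F.pos s₀ hs₀
  have hp' := hR s₀ hs₀
  simp [hsymm (B s₀) (T s₀), hsymm (B s₀) (N s₀), O.TB, O.NB, O.BB, hp.ne', hp'.ne'] at h1

/-- Two Frenet systems whose principal normals are parallel at corresponding parameters differ by
a constant rotation. -/
theorem rotation_of_parallel_normals {J : Set ℝ} {T' N' B' : ℝ → V} {κ' σ' φ ψ : ℝ → ℝ}
    (F : IsFrenetSystem ip I T N B κ σ) (F' : IsFrenetSystem ip J T' N' B' κ' σ')
    (hI : IsOpen I) (hc : IsPreconnected I)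
    (hsymm : ∀ v w, ip v w = ip w v) (hV : Module.finrank ℝ V = 3)
    (hφ : ∀ s ∈ I, HasDerivAt φ (ψ s) s) (hmaps : Set.MapsTo φ I J)
    (hN : ∀ s ∈ I, ∃ c : ℝ, N' (φ s) = c • N s) :
    ∃ x y ε δ : ℝ, ∀ s ∈ I, x ^ 2 + y ^ 2 = 1 ∧ ε ^ 2 = 1 ∧ δ ^ 2 = 1 ∧
      T' (φ s) = x • T s + y • B s ∧ N' (φ s) = ε • N s ∧
      ψ s * (ε * κ' (φ s)) = x * κ s - y * σ s ∧ ψ s * (δ * σ' (φ s)) = y * κ s + x * σ s := by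
  have O := F.orthonormal
  have O' : ∀ s ∈ I, IsOrthonormalTriple ip (T' (φ s)) (N' (φ s)) (B' (φ s)) :=
    fun s hs => F'.orthonormal _ (hmaps hs)
  have hTd : ∀ s ∈ I, HasDerivAt (fun t => T' (φ t)) (ψ s • (κ' (φ s) • N' (φ s))) s :=
    fun s hs => (F'.deriv_T _ (hmaps hs)).scomp s (hφ s hs)
  have hNd : ∀ s ∈ I, HasDerivAt (fun t => N' (φ t))
      (ψ s • (-κ' (φ s) • T' (φ s) + σ' (φ s) • B' (φ s))) s :=
    fun s hs => (F'.deriv_N _ (hmaps hs)).scomp s (hφ s hs)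
  have hBd : ∀ s ∈ I, HasDerivAt (fun t => B' (φ t)) (ψ s • (-σ' (φ s) • N' (φ s))) s :=
    fun s hs => (F'.deriv_B _ (hmaps hs)).scomp s (hφ s hs)
  have hN0 : ∀ s ∈ I, ∃ c : ℝ, c ≠ 0 ∧ N' (φ s) = c • N s := fun s hs => by
    obtain ⟨c, hc⟩ := hN s hs
    refine ⟨c, ?_, hc⟩
    rintro rfl
    have := (O' s hs).NN
    simp [hc] at this
  have hT'N : ∀ s ∈ I, ip (T' (φ s)) (N s) = 0 := fun s hs => by
    obtain ⟨c, hc0, hc⟩ := hN0 s hs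
    have := (O' s hs).TN
    simpa [hc, hc0] using this
  have hB'N : ∀ s ∈ I, ip (B' (φ s)) (N s) = 0 := fun s hs => by
    obtain ⟨c, hc0, hc⟩ := hN0 s hs
    have := (O' s hs).NB
    rw [hsymm] at this
    simpa [hc, hc0] using this
  have hN'T : ∀ s ∈ I, ip (N' (φ s)) (T s) = 0 := fun s hs => by
    obtain ⟨c, hc0, hc⟩ := hN0 s hs
    simp [hc, hsymm (N s), (O s hs).TN]
  have hN'B : ∀ s ∈ I, ip (N' (φ s)) (B s) = 0 := fun s hs => by
    obtain ⟨c, hc0, hc⟩ := hN0 s hs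
    simp [hc, (O s hs).NB]
  -- All these products are constant for one reason: their derivatives only pair normals with
  -- tangents or binormals, or pair ⟨N',N⟩-type products whose differentiated factor has no normal
  -- component.
  obtain ⟨x, hx⟩ := exists_const_of_hasDerivAt_zero (f := fun s => ip (T' (φ s)) (T s)) hI hc
    (fun s hs => by
      refine (hasDerivAt_form ip (hTd s hs) (F.deriv_T s hs)).congr_deriv ?_
      simp [hN'T s hs, hT'N s hs])
  obtain ⟨y, hy⟩ := exists_const_of_hasDerivAt_zero (f := fun s => ip (T' (φ s)) (B s)) hI hc
    (fun s hs => by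
      refine (hasDerivAt_form ip (hTd s hs) (F.deriv_B s hs)).congr_deriv ?_
      simp [hN'B s hs, hT'N s hs])
  obtain ⟨ε, hε⟩ := exists_const_of_hasDerivAt_zero (f := fun s => ip (N' (φ s)) (N s)) hI hc
    (fun s hs => by
      refine (hasDerivAt_form ip (hNd s hs) (F.deriv_N s hs)).congr_deriv ?_
      simp [hN'B s hs, hT'N s hs, hN'T s hs, hB'N s hs])
  obtain ⟨z, hz⟩ := exists_const_of_hasDerivAt_zero (f := fun s => ip (B' (φ s)) (T s)) hI hc
    (fun s hs => by
      refine (hasDerivAt_form ip (hBd s hs) (F.deriv_T s hs)).congr_deriv ?_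
      simp [hN'T s hs, hB'N s hs])
  obtain ⟨w, hw⟩ := exists_const_of_hasDerivAt_zero (f := fun s => ip (B' (φ s)) (B s)) hI hc
    (fun s hs => by
      refine (hasDerivAt_form ip (hBd s hs) (F.deriv_B s hs)).congr_deriv ?_
      simp [hN'B s hs, hB'N s hs])
  have hT' : ∀ s ∈ I, T' (φ s) = x • T s + y • B s := fun s hs => by
    conv_lhs => rw [(O s hs).eq_sum hsymm hV (T' (φ s))]
    rw [hx s hs, hy s hs, hT'N s hs]; simp
  have hN' : ∀ s ∈ I, N' (φ s) = ε • N s := fun s hs => by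
    conv_lhs => rw [(O s hs).eq_sum hsymm hV (N' (φ s))]
    rw [hN'T s hs, hε s hs, hN'B s hs]; simp
  have hB' : ∀ s ∈ I, B' (φ s) = z • T s + w • B s := fun s hs => by
    conv_lhs => rw [(O s hs).eq_sum hsymm hV (B' (φ s))]
    rw [hz s hs, hw s hs, hB'N s hs]; simp
  -- The factor xw − yz = ±1 is the determinant of the change from (T,B) to (T',B'), so δ records
  -- both orientation signs. The relations among the constants stand under s ∈ I because I may be
  -- empty here.
  refine ⟨x, y, ε, ε * (x * w - y * z), fun s hs => ?_⟩
  have BT : ip (B s) (T s) = 0 := by rw [hsymm, (O s hs).TB]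
  have h1 := (O' s hs).TT
  have h2 := (O' s hs).NN
  have h3 := (O' s hs).BB
  have h4 := (O' s hs).TB
  rw [hT' s hs] at h1 h4
  rw [hN' s hs] at h2
  rw [hB' s hs] at h3 h4
  simp [(O s hs).TT, (O s hs).TB, (O s hs).BB, (O s hs).NN, BT] at h1 h2 h3 h4
  have h5 : ψ s * (ε * κ' (φ s)) = x * κ s - y * σ s := by
    have := HasDerivAt.eq_of_eqOn hI hs (hTd s hs)
      (((F.deriv_T s hs).const_smul x).add ((F.deriv_B s hs).const_smul y)) hT'
    have := congrArg (ip (N s)) this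
    simp [hN' s hs, (O s hs).NN] at this
    linarith
  have h6 : ψ s * (-σ' (φ s) * ε) = z * κ s - w * σ s := by
    have := HasDerivAt.eq_of_eqOn hI hs (hBd s hs)
      (((F.deriv_T s hs).const_smul z).add ((F.deriv_B s hs).const_smul w)) hB'
    have := congrArg (ip (N s)) this
    simp [hN' s hs, (O s hs).NN] at this
    linarith
  have h7 : (x * w - y * z) ^ 2 = 1 := by
    linear_combination (z ^ 2 + w ^ 2) * h1 + h3 - (x * z + y * w) * h4
  have h8 : z = -(x * w - y * z) * y := by
    linear_combination x * h4 - z * h1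
  have h9 : w = (x * w - y * z) * x := by
    linear_combination y * h4 - w * h1
  refine ⟨by linarith, by linarith, by linear_combination (x * w - y * z) ^ 2 * h2 + h7, hT' s hs,
    hN' s hs, h5, ?_⟩
  linear_combination (-(x * w - y * z)) * h6 - (x * w - y * z) * κ s * h8
    + (x * w - y * z) * σ s * h9 + (y * κ s + x * σ s) * h7

end IsFrenetSystem
end Frame

/-! ### Trigonometric primitives and the elimination. -/

/-- The primitives of `t ↦ cos (c * t)` and `t ↦ sin (c * t)` which vanish at `0`. -/
theorem exists_sin_cos_primitive (c : ℝ) : ∃ S C : ℝ → ℝ, S 0 = 0 ∧ C 0 = 0 ∧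
    (∀ t, HasDerivAt S (1 - c * C t) t) ∧ (∀ t, HasDerivAt C (c * S t) t) ∧
    ∀ t, (c * S t) ^ 2 + (1 - c * C t) ^ 2 = 1 := by
  -- Writing cos(ct) as 1 − cC and sin(ct) as cS lets the flat case c = 0, where the normal lines
  -- behave as in ℝ³, be treated together with the others.
  rcases eq_or_ne c 0 with rfl | hc
  · exact ⟨fun t => t, fun _ => 0, rfl, rfl, fun t => by simpa using! hasDerivAt_id t,
      fun t => by simpa using hasDerivAt_const t (0 : ℝ), fun t => by simp⟩
  · refine ⟨fun t => Real.sin (c * t) / c, fun t => (1 - Real.cos (c * t)) / c, by simp, by simp,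
      fun t => ?_, fun t => ?_, fun t => ?_⟩
    · refine ((((hasDerivAt_id t).const_mul c).sin).div_const c).congr_deriv ?_
      simp only [id]
      field_simp
      ring
    · refine (((((hasDerivAt_id t).const_mul c).cos).const_sub 1).div_const c).congr_deriv ?_
      simp only [id]
      field_simp
    · have := Real.sin_sq_add_cos_sq (c * t)
      field_simp
      linear_combination this

/-- Here P stands for φ', and k, q for the mate's curvature and torsion up to sign. The combination
cS·(first) − (1−cC)·(second) is free of the constant term, and inverting the rotation (x,y) writes κ
and σ as P times linear forms in k and q; so P cancels. The coefficients satisfy a² + b² = S² + C²,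
hence do not both vanish. -/
theorem exists_linear_relation {c S C x y : ℝ} (hSC : S ≠ 0 ∨ C ≠ 0)
    (hc : (c * S) ^ 2 + (1 - c * C) ^ 2 = 1) (hxy : x ^ 2 + y ^ 2 = 1) :
    ∃ a b d : ℝ, (a ≠ 0 ∨ b ≠ 0) ∧ ∀ P κ σ k q : ℝ, κ ≠ 0 →
      P * x = 1 - c * C - κ * S - σ * C → P * y = c * S - κ * C + σ * S →
      P * k = x * κ - y * σ → P * q = y * κ + x * σ → a * k + b * q = d := by
  refine ⟨c * S * (S * x - C * y) - (1 - c * C) * (S * y + C * x),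
    c * S * (S * y + C * x) + (1 - c * C) * (S * x - C * y), (1 - c * C) * y - c * S * x, ?_, ?_⟩
  · by_contra! h
    obtain ⟨h1, h2⟩ := h
    generalize hu : c * S = u at *
    generalize hv : 1 - c * C = v at *
    have h3 : S ^ 2 + C ^ 2 = 0 := by
      linear_combination (-(S ^ 2 + C ^ 2)) * hc - (S ^ 2 + C ^ 2) * (u ^ 2 + v ^ 2) * hxy
        + (u * (S * x - C * y) - v * (S * y + C * x)) * h1
        + (u * (S * y + C * x) + v * (S * x - C * y)) * h2
    rcases hSC with h | h
    · have : 0 < S ^ 2 + C ^ 2 := by positivity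
      linarith
    · have : 0 < S ^ 2 + C ^ 2 := by positivity
      linarith
  · intro P κ σ k q hκ h1 h2 h3 h4
    -- If P = 0, the rotation would send (κ,σ) to 0, contradicting κ ≠ 0.
    have hP : P ≠ 0 := by
      rintro rfl
      apply hκ
      linear_combination (-κ) * hxy - x * h3 - y * h4
    apply mul_left_cancel₀ hP
    linear_combination (c * S * (S * x - C * y) - (1 - c * C) * (S * y + C * x)) * h3 +
      (c * S * (S * y + C * x) + (1 - c * C) * (S * x - C * y)) * h4 + c * S * h1
      - (1 - c * C) * h2 + (κ * (c * S ^ 2 - (1 - c * C) * C) + σ * (c * S * C + (1 - c * C) * S)) * hxy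

/-! ### Invariant brackets in dimension three. -/

section Bracket
variable {V : Type*} [NormedAddCommGroup V] [NormedSpace ℝ V]

/-- An antisymmetric product for which the form `ip` is invariant. -/
structure IsInvariantBracket (ip : V →L[ℝ] V →L[ℝ] ℝ) (br : V →L[ℝ] V →L[ℝ] V) : Prop where
  symm : ∀ v w, ip v w = ip w v
  pos : ∀ v, v ≠ 0 → 0 < ip v v
  self : ∀ v, br v v = 0
  invariant : ∀ v w, ip v (br v w) = 0

namespace IsInvariantBracket

variable {ip : V →L[ℝ] V →L[ℝ] ℝ} {br : V →L[ℝ] V →L[ℝ] V} (h : IsInvariantBracket ip br)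
include h

theorem anti (v w : V) : br v w = -br w v := by
  have := h.self (v + w)
  simp only [map_add, add_apply, h.self] at this
  rw [eq_neg_iff_add_eq_zero, ← this]; abel

theorem swap (u v w : V) : ip u (br v w) = -ip v (br u w) := by
  have := h.invariant (u + v) w
  simp only [map_add, add_apply, h.invariant] at this
  linarith

theorem cyclic (u v w : V) : ip (br u v) w = ip (br v w) u := by
  rw [h.symm, h.symm (br v w), h.swap w, h.anti w v, map_neg, neg_neg]

/-- By invariance br T N is orthogonal to T and N, hence a multiple of B; cyclic symmetry of ip (br
u v) w makes the three factors equal. -/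
theorem table {T N B : V} (O : IsOrthonormalTriple ip T N B) (hV : Module.finrank ℝ V = 3) :
    br T N = ip (br T N) B • B ∧ br N B = ip (br T N) B • T ∧ br B T = ip (br T N) B • N := by
  have key : ∀ {T N B : V} (_ : IsOrthonormalTriple ip T N B), br T N = ip (br T N) B • B := by
    intro T N B O
    conv_lhs => rw [O.eq_sum h.symm hV (br T N)]
    rw [h.symm _ T, h.invariant, h.symm _ N, h.anti T N, map_neg, h.invariant]
    simp
  have O1 : IsOrthonormalTriple ip N B T :=
    ⟨O.NN, O.BB, O.TT, O.NB, by rw [h.symm, O.TN], by rw [h.symm, O.TB]⟩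
  have O2 : IsOrthonormalTriple ip B T N :=
    ⟨O.BB, O.TT, O.NN, by rw [h.symm, O.TB], by rw [h.symm, O.NB], O.TN⟩
  refine ⟨key O, ?_, ?_⟩
  · rw [h.cyclic T N B]; exact key O1
  · rw [h.cyclic T N B, h.cyclic N B T]; exact key O2

/-- After inserting the Frenet equations every term has a repeated vector. The constancy of this
coefficient makes the Bertrand relation have constant coefficients. -/
theorem hasDerivAt_bracket_coeff {T N B : ℝ → V} {κ σ : ℝ → ℝ} {I : Set ℝ}
    (F : IsFrenetSystem ip I T N B κ σ) {s : ℝ} (hs : s ∈ I) :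
    HasDerivAt (fun t => ip (br (T t) (N t)) (B t)) 0 s := by
  have h1 := hasDerivAt_form ip ((br.hasFDerivAt.comp_hasDerivAt s (F.deriv_T s hs)).clm_apply
    (F.deriv_N s hs)) (F.deriv_B s hs)
  refine h1.congr_deriv ?_
  have e1 : ip (br (T s) (N s)) (N s) = 0 := by
    rw [h.symm, h.anti, map_neg, h.invariant, neg_zero]
  have e2 : ip (br (T s) (B s)) (B s) = 0 := by
    rw [h.symm, h.anti, map_neg, h.invariant, neg_zero]
  simp [h.self, e1, e2]

/-- The difference Z of two solutions satisfies Z' = br Z N, and by invariance ip Z Z is constant.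
-/
theorem eq_of_hasDerivAt {N n : V} {X Y : ℝ → V} (hX : ∀ t, HasDerivAt X (n + br (X t) N) t)
    (hY : ∀ t, HasDerivAt Y (n + br (Y t) N) t) (h0 : X 0 = Y 0) (t : ℝ) : X t = Y t := by
  have hd : ∀ t, HasDerivAt (fun t => ip (X t - Y t) (X t - Y t)) 0 t := fun t => by
    have h1 := (hX t).sub (hY t)
    refine (hasDerivAt_form ip h1 h1).congr_deriv ?_
    have e : n + br (X t) N - (n + br (Y t) N) = br (X t - Y t) N := by
      simp
    rw [e, Pi.sub_apply, h.symm, h.invariant, add_zero]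
  have hc := is_const_of_deriv_eq_zero (fun t => (hd t).differentiableAt) (fun t => (hd t).deriv) t 0
  simp only [h0, sub_self, map_zero] at hc
  by_contra hne
  exact (h.pos _ (sub_ne_zero.2 hne)).ne' hc

/-- The solution of the equation of the variation field along a principal normal line. -/
theorem solve {T N B : V} (O : IsOrthonormalTriple ip T N B) (hV : Module.finrank ℝ V = 3)
    {c x₀ κ σ : ℝ} (hc : ip (br T N) B = c) {S C : ℝ → ℝ} (hS0 : S 0 = 0) (hC0 : C 0 = 0)
    (hS : ∀ t, HasDerivAt S (1 - c * C t) t) (hC : ∀ t, HasDerivAt C (c * S t) t) {X : ℝ → V}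
    (hX : ∀ t, HasDerivAt X (-κ • T + σ • B + br (X t) N) t) (hX0 : X 0 = x₀ • T) (t : ℝ) :
    X t = (x₀ * (1 - c * C t) - κ * S t - σ * C t) • T +
      (x₀ * (c * S t) - κ * C t + σ * S t) • B := by
  obtain ⟨h1, h2, -⟩ := h.table O hV
  rw [hc] at h1 h2
  have h3 : br B N = -c • T := by rw [h.anti, h2, neg_smul]
  -- The plane of T and B is preserved, since br T N = cB and br B N = −cT. The value x₀ = 1 serves
  -- the normal lines of the curve, x₀ = 0 the same lines translated back to start at 1.
  refine h.eq_of_hasDerivAt hX (Y := fun t => (x₀ * (1 - c * C t) - κ * S t - σ * C t) • T +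
    (x₀ * (c * S t) - κ * C t + σ * S t) • B) (fun t => ?_) (by simp [hX0, hS0, hC0]) t
  refine ((((((hC t).const_mul c).const_sub 1 |>.const_mul x₀).sub ((hS t).const_mul κ)).sub
    ((hC t).const_mul σ)).smul_const T |>.add
    (((((hS t).const_mul c).const_mul x₀).sub ((hC t).const_mul κ)).add
      ((hS t).const_mul σ) |>.smul_const B)).congr_deriv ?_
  simp only [map_add, map_smul, add_apply, smul_apply, h1,
    h3]
  module

end IsInvariantBracket
end Bracket

/-! ### Curves in the group as Frenet systems, and variation along normal lines. -/

noncomputable section LieGroupCurves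

variable {E : Type*} [NormedAddCommGroup E] [NormedSpace ℝ E]
  {G : Type*} [TopologicalSpace G] [ChartedSpace E G] [Group G] [LieGroup 𝓘(ℝ, E) ∞ G]

theorem exists_bracket_clm [FiniteDimensional ℝ E] :
    ∃ br : E →L[ℝ] E →L[ℝ] E, ∀ v w, br v w = algBracket G v w := by
  have : CompleteSpace E := FiniteDimensional.complete ℝ E
  have : LieGroup 𝓘(ℝ, E) (minSmoothness ℝ 3) G := by
    rw [minSmoothness_of_isRCLikeNormedField]; infer_instance
  let A := GroupLieAlgebra 𝓘(ℝ, E) G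
  let b : E →ₗ[ℝ] E →ₗ[ℝ] E := LinearMap.mk₂ ℝ (algBracket G)
    (fun u v w : A => add_lie u v w) (fun c (u v : A) => smul_lie c u v)
    (fun u v w : A => lie_add u v w) (fun c (u v : A) => lie_smul c u v)
  exact ⟨LinearMap.toContinuousLinearMap
    ((LinearMap.toContinuousLinearMap : (E →ₗ[ℝ] E) ≃ₗ[ℝ] (E →L[ℝ] E)).toLinearMap ∘ₗ b),
    fun v w => rfl⟩

omit [LieGroup 𝓘(ℝ, E) ∞ G] in
theorem algBracket_self (v : E) : algBracket G v v = 0 :=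
  congrFun (VectorField.mlieBracket_self (I := 𝓘(ℝ, E)) (V := mulInvariantVectorField v)) (1 : G)

theorem isInvariantBracket_algBracket [FiniteDimensional ℝ E] {g : LieMetric E G}
    (hg : IsBiInvariant g) {br : E →L[ℝ] E →L[ℝ] E} (hbr : ∀ v w, br v w = algBracket G v w) :
    IsInvariantBracket (metricForm g 1) br where
  symm := metricForm_symm g 1
  pos v hv := g.pos 1 v hv
  self v := by rw [hbr, algBracket_self]
  invariant v w := by rw [hbr, metricForm_algBracket_self hg]

/-- In the left-invariant frame, the Frenet apparatus of a curve in a three-dimensional group is a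
Euclidean Frenet system with torsion `τ - τ_G`. -/
theorem IsFrenetCurve.isFrenetSystem [FiniteDimensional ℝ E] (hE : Module.finrank ℝ E = 3) {g : LieMetric E G}
    (hg : IsBiInvariant g) {I : Set ℝ} {α : ℝ → G} {F : FrenetData E G}
    (hα : IsFrenetCurve g I α F) :
    IsFrenetSystem (V := E) (metricForm g 1) I F.T F.N F.B F.κ (fun s => F.τ s - F.tauG g s) := by
  obtain ⟨br, hbr⟩ := exists_bracket_clm (E := E) (G := G)
  let T : ℝ → E := F.T
  let N : ℝ → E := F.N
  let B : ℝ → E := F.B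
  have h := isInvariantBracket_algBracket hg hbr
  have O : ∀ s ∈ I, IsOrthonormalTriple (V := E) (metricForm g 1) (T s) (N s) (B s) :=
    fun s hs => ⟨hα.inner_TT s hs, hα.inner_NN s hs, hα.inner_BB s hs, hα.inner_TN s hs,
      hα.inner_TB s hs, hα.inner_NB s hs⟩
  have hd : ∀ {W : ℝ → E}, ContDiffOn ℝ ∞ W I → ∀ s ∈ I, HasDerivAt W (deriv W s) s :=
    fun hW s hs => ((hW.contDiffAt (hα.isOpen.mem_nhds hs)).differentiableAt (by simp)).hasDerivAt
  have htau : ∀ s, F.tauG g s = 1 / 2 * metricForm g 1 (br (T s) (N s)) (B s) := fun s => by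
    rw [hbr]; rfl
  refine ⟨O, fun s hs => ?_, fun s hs => ?_, fun s hs => ?_, hα.curvature_pos⟩
  · have h1 : deriv T s + (1 / 2 : ℝ) • algBracket G (T s) (T s) = F.κ s • N s :=
      hα.frenet_T s hs
    rw [algBracket_self, smul_zero, add_zero] at h1
    exact h1 ▸ hd hα.smooth_T s hs
  · have h1 : deriv N s + (1 / 2 : ℝ) • algBracket G (T s) (N s) =
      -F.κ s • T s + F.τ s • B s := hα.frenet_N s hs
    refine (hd hα.smooth_N s hs).congr_deriv ?_
    -- Half of the bracket [T,N] is τ_G B, which turns τ into τ − τ_G.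
    rw [← hbr, (h.table (O s hs) hE).1] at h1
    change deriv N s = -F.κ s • T s + (F.τ s - F.tauG g s) • B s
    rw [htau, eq_sub_of_add_eq h1]
    module
  · have h1 : deriv B s + (1 / 2 : ℝ) • algBracket G (T s) (B s) =
      -F.τ s • N s := hα.frenet_B s hs
    refine (hd hα.smooth_B s hs).congr_deriv ?_
    rw [← hbr, h.anti, (h.table (O s hs) hE).2.2] at h1
    change deriv B s = -(F.τ s - F.tauG g s) • N s
    rw [htau, eq_sub_of_add_eq h1]
    module

/-- The variation field of a family of integral curves of left-invariant vector fields. -/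
theorem exists_normal_variation [FiniteDimensional ℝ E] {Γ : ℝ × ℝ → G} {I : Set ℝ} (hI : IsOpen I)
    (hΓ : ContMDiffOn 𝓘(ℝ, ℝ × ℝ) 𝓘(ℝ, E) ∞ Γ (I ×ˢ Set.univ)) {N : ℝ → E}
    (hN : ∀ s ∈ I, ∀ t, HasLeftDerivAt (fun t => Γ (s, t)) (N s) t) {s : ℝ} (hs : s ∈ I) {n v : E}
    (hn : HasDerivAt N n s) (hv : HasLeftDerivAt (fun s => Γ (s, 0)) v s) :
    ∃ X : ℝ → E, X 0 = v ∧ (∀ t, HasDerivAt X (n + algBracket G (X t) (N s)) t) ∧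
      ∀ t, HasLeftDerivAt (fun s => Γ (s, t)) (X t) s := by
  have hopen : IsOpen (I ×ˢ (Set.univ : Set ℝ)) := hI.prod isOpen_univ
  have hΓ' : ∀ q ∈ I ×ˢ (Set.univ : Set ℝ), ContMDiffAt 𝓘(ℝ, ℝ × ℝ) 𝓘(ℝ, E) ∞ Γ q :=
    fun q hq => hΓ.contMDiffAt (hopen.mem_nhds hq)
  have hslice : ∀ q ∈ I ×ˢ (Set.univ : Set ℝ),
      MDifferentiableAt 𝓘(ℝ, ℝ) 𝓘(ℝ, E) (fun u => Γ (u, q.2)) q.1 := fun q hq => by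
    have h1 : DifferentiableAt ℝ (fun u : ℝ => (u, q.2)) q.1 := by fun_prop
    exact MDifferentiableAt.comp q.1 (f := fun u : ℝ => (u, q.2))
      ((hΓ' q hq).mdifferentiableAt (by simp)) h1.mdifferentiableAt
  -- The principal filter yields one field X on the whole strip, so that it can be differentiated at
  -- every t.
  obtain ⟨X, hX⟩ := exists_eventually_hasLeftDerivAt
    (Γ := fun (q : ℝ × ℝ) u => Γ (u, q.2)) (f := Prod.fst) (l := 𝓟 (I ×ˢ (Set.univ : Set ℝ))) hslice
  rw [eventually_principal] at hX
  refine ⟨fun t => X (s, t), (hX (s, 0) ⟨hs, trivial⟩).unique hv, fun t => ?_,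
    fun t => hX (s, t) ⟨hs, trivial⟩⟩
  have hmem : ∀ᶠ q in 𝓝 (s, t), q ∈ I ×ˢ (Set.univ : Set ℝ) := hopen.mem_nhds ⟨hs, trivial⟩
  -- The t-velocity N(s) does not depend on t, so Maurer–Cartan becomes a linear differential
  -- equation in t for X.
  obtain ⟨hXd, hYd, hMC⟩ := maurerCartan (Y := fun q => N q.1)
    ((hΓ' (s, t) ⟨hs, trivial⟩).of_le ENat.LEInfty.out)
    (hmem.mono hX) (hmem.mono fun q hq => hN q.1 hq.1 q.2)
  have h1 : fderiv ℝ (fun q : ℝ × ℝ => N q.1) (s, t) (1, 0) = n :=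
    (hYd.hasFDerivAt.comp_hasDerivAt (f := fun u : ℝ => (u, t)) s
      ((hasDerivAt_id s).prodMk (hasDerivAt_const s t))).unique hn
  rw [h1] at hMC
  rw [← hMC, add_sub_cancel]
  exact hXd.hasFDerivAt.comp_hasDerivAt t ((hasDerivAt_const t s).prodMk (hasDerivAt_id t))

omit [LieGroup 𝓘(ℝ, E) ∞ G] in
theorem HasLeftDerivAt.diag {Γ : ℝ × ℝ → G} {v w : E} {r : ℝ → ℝ} {r' s : ℝ}
    (hΓ : MDifferentiableAt 𝓘(ℝ, ℝ × ℝ) 𝓘(ℝ, E) Γ (s, r s))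
    (h1 : HasLeftDerivAt (fun u => Γ (u, r s)) v s) (h2 : HasLeftDerivAt (fun t => Γ (s, t)) w (r s))
    (hr : HasDerivAt r r' s) : HasLeftDerivAt (fun u => Γ (u, r u)) (v + r' • w) s := by
  let D : ℝ × ℝ →L[ℝ] E := mfderiv 𝓘(ℝ, ℝ × ℝ) 𝓘(ℝ, E) Γ (s, r s)
  have h0 : ∀ q, q = (s, r s) → HasMFDerivAt 𝓘(ℝ, ℝ × ℝ) 𝓘(ℝ, E) Γ q D := by
    rintro _ rfl
    exact hΓ.hasMFDerivAt
  have key : ∀ {f : ℝ → ℝ × ℝ} {f' : ℝ × ℝ} {u : ℝ} (_ : HasDerivAt f f' u) (_ : f u = (s, r s)),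
      HasMFDerivAt 𝓘(ℝ, ℝ) 𝓘(ℝ, E) (fun u => Γ (f u)) u (velocityMap (E := E) (D f')) := by
    intro f f' u hf hu
    refine (HasMFDerivAt.comp u (h0 (f u) hu) hf.hasFDerivAt.hasMFDerivAt).congr_mfderiv ?_
    refine ContinuousLinearMap.ext fun (x : ℝ) => ?_
    change D (x • f') = x • D f'
    rw [map_smul]
  have hval : ∀ {a b : E}, velocityMap a = velocityMap b → a = b := fun {a b} h => by
    simpa [velocityMap] using DFunLike.congr_fun h (1 : ℝ)
  have e1 := hval (hasMFDerivAt_unique h1 (key ((hasDerivAt_id s).prodMk (hasDerivAt_const s (r s))) rfl))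
  have e2 := hval (hasMFDerivAt_unique h2
    (key ((hasDerivAt_const (r s) s).prodMk (hasDerivAt_id (r s))) rfl))
  refine (key ((hasDerivAt_id s).prodMk hr) rfl).congr_mfderiv ?_
  have : D (1, r') = leftDiff (Γ (s, r s)) 1 (v + r' • w) := by
    rw [map_add, map_smul, e1, e2, ← map_smul, ← map_add]
    simp
  rw [this]

end LieGroupCurves

/-! ### Bertrand pairs. -/

noncomputable section BertrandPairs

variable {E : Type*} [NormedAddCommGroup E] [NormedSpace ℝ E]
  {G : Type*} [TopologicalSpace G] [ChartedSpace E G] [Group G] [LieGroup 𝓘(ℝ, E) ∞ G]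

omit [LieGroup 𝓘(ℝ, E) ∞ G] in
theorem hasLeftDerivAt_const (a : G) (s : ℝ) : HasLeftDerivAt (fun _ => a) (0 : E) s := by
  refine (hasMFDerivAt_const a s).congr_mfderiv ?_
  have : velocityMap (leftDiff a 1 (0 : E)) = 0 := by simp [velocityMap]
  rw [this]; rfl

omit [LieGroup 𝓘(ℝ, E) ∞ G] in
theorem HasLeftDerivAt.congr_of_eqOn {γ γ' : ℝ → G} {v : E} {s : ℝ} {I : Set ℝ} (hI : IsOpen I)
    (hs : s ∈ I) (h : HasLeftDerivAt γ v s) (heq : ∀ t ∈ I, γ' t = γ t) :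
    HasLeftDerivAt γ' v s := by
  have := HasMFDerivAt.congr_of_eventuallyEq h (eventually_of_mem (hI.mem_nhds hs) heq)
  unfold HasLeftDerivAt
  rw [heq s hs]
  exact this

/-- For a Bertrand pair, curvature and reduced torsion of the mate satisfy a linear relation with
constant coefficients, and the principal normals agree up to a constant factor. -/
theorem bertrand_linear_relation [FiniteDimensional ℝ E] (hE : Module.finrank ℝ E = 3)
    {g : LieMetric E G} (hg : IsBiInvariant g) {I J : Set ℝ} {α β : ℝ → G} {F F' : FrenetData E G}
    (hα : IsFrenetCurve g I α F) (hβ : IsFrenetCurve g J β F') (hpair : IsBertrandPair I α F J β F') :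
    ∃ (φ : ℝ → ℝ) (ε a b d : ℝ), Set.BijOn φ I J ∧ ε ≠ 0 ∧
      (∀ s ∈ I, (F'.N (φ s) : E) = ε • (F.N s : E)) ∧ (a ≠ 0 ∨ b ≠ 0) ∧
      ∀ s ∈ J, a * F'.κ s + b * (F'.τ s - F'.tauG g s) = d := by
  obtain ⟨φ, r, Γ, hφ, hbij, hr, hΓ, hβΓ, hN, hz⟩ := hpair
  obtain ⟨br, hbr⟩ := exists_bracket_clm (E := E) (G := G)
  have h := isInvariantBracket_algBracket hg hbr
  have hI := hα.isOpen
  have hc := hα.ordConnected.isPreconnected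
  have S := hα.isFrenetSystem hE hg
  have S' := hβ.isFrenetSystem hE hg
  obtain ⟨s₀, hs₀⟩ : I.Nonempty := by
    by_contra hne
    rw [Set.not_nonempty_iff_eq_empty] at hne
    exact hz ⟨1, by simp [hne]⟩
  let T : ℝ → E := F.T
  let N : ℝ → E := F.N
  let B : ℝ → E := F.B
  let T' : ℝ → E := F'.T
  let σ : ℝ → ℝ := fun s => F.τ s - F.tauG g s
  change IsFrenetSystem (metricForm g 1) I T N B F.κ σ at S
  have hderiv : ∀ {f : ℝ → ℝ}, ContDiffOn ℝ ∞ f I → ∀ s ∈ I, HasDerivAt f (deriv f s) s :=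
    fun hf s hs => ((hf.contDiffAt (hI.mem_nhds hs)).differentiableAt (by simp)).hasDerivAt
  obtain ⟨x, y, ε, δ, hrot⟩ := S.rotation_of_parallel_normals S' hI hc h.symm hE (hderiv hφ)
    hbij.mapsTo hN
  obtain ⟨c, hc'⟩ := exists_const_of_hasDerivAt_zero hI hc
    (fun s hs => h.hasDerivAt_bracket_coeff S hs)
  obtain ⟨P, Q, hP0, hQ0, hP, hQ, hPQ⟩ := exists_sin_cos_primitive c
  have hgeo : ∀ s ∈ I, ∀ t, HasLeftDerivAt (Γ s) (N s) t := fun s hs t => hΓ.geodesic s hs t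
  have hvel : ∀ s ∈ I, HasLeftDerivAt α (T s) s := fun s hs => hα.velocity s hs
  have hsmooth : ∀ s ∈ I, MDifferentiableAt 𝓘(ℝ, ℝ × ℝ) 𝓘(ℝ, E) (fun p : ℝ × ℝ => Γ p.1 p.2)
      (s, r s) := fun s hs =>
    (hΓ.smooth.contMDiffAt ((hI.prod isOpen_univ).mem_nhds ⟨hs, trivial⟩)).mdifferentiableAt
      (by simp)
  -- Both sides are the velocity of β ∘ φ: by reparametrizing β, and by the variation of the normal
  -- lines at t = r(s).
  have hmate : ∀ s ∈ I, deriv φ s • (x • T s + y • B s) =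
      ((1 * (1 - c * Q (r s)) - F.κ s * P (r s) - σ s * Q (r s)) • T s +
        (1 * (c * P (r s)) - F.κ s * Q (r s) + σ s * P (r s)) • B s) + deriv r s • N s := by
    intro s hs
    obtain ⟨X, hX0, hX, hXΓ⟩ := exists_normal_variation hI hΓ.smooth hgeo hs (S.deriv_N s hs)
      ((hvel s hs).congr_of_eqOn hI hs hΓ.start)
    simp only [← hbr] at hX
    rw [← h.solve (S.orthonormal s hs) hE (hc' s hs) hP0 hQ0 hP hQ hX (by rw [hX0, one_smul]) (r s),
      ← (hrot s hs).2.2.2.1]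
    have h1 : HasLeftDerivAt β (T' (φ s)) (φ s) := hβ.velocity _ (hbij.mapsTo hs)
    exact ((h1.comp (hderiv hφ s hs)).congr_of_eqOn hI hs fun t ht => (hβΓ t ht).symm).unique
      (HasLeftDerivAt.diag (hsmooth s hs) (hXΓ (r s)) (hgeo s hs (r s)) (hderiv hr s hs))
  have hr' : ∀ s ∈ I, deriv r s = 0 := fun s hs => by
    have O := S.orthonormal s hs
    have h1 := congrArg (metricForm g 1 (N s)) (hmate s hs)
    simpa [O.NN, O.NB, h.symm (N s) (T s), O.TN, eq_comm] using h1
  obtain ⟨r₀, hr₀⟩ := exists_const_of_hasDerivAt_zero hI hc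
    (fun s hs => hr' s hs ▸ hderiv hr s hs)
  -- If both vanish, the variation field of (α s)⁻¹ Γ s, which starts at 0, is again 0 at r₀. Hence
  -- (α s)⁻¹ Γ s r₀ is a fixed element and the mate is trivial.
  have hPQ0 : P r₀ ≠ 0 ∨ Q r₀ ≠ 0 := by
    by_contra! h0
    apply hz
    have hzero : ∀ s ∈ I, HasLeftDerivAt (fun s => (α s)⁻¹ * Γ s r₀) (0 : E) s := by
      intro s hs
      have hsm : ContMDiffOn 𝓘(ℝ, ℝ × ℝ) 𝓘(ℝ, E) ∞ (fun p : ℝ × ℝ => (α p.1)⁻¹ * Γ p.1 p.2)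
          (I ×ˢ Set.univ) := by
        refine ContMDiffOn.mul (ContMDiffOn.inv ?_) hΓ.smooth
        exact hα.smooth.comp (f := Prod.fst) (I' := 𝓘(ℝ, ℝ)) contDiff_fst.contMDiff.contMDiffOn
          fun p hp => hp.1
      obtain ⟨X, hX0, hX, hXΓ⟩ := exists_normal_variation hI hsm
        (fun s hs t => (hgeo s hs t).const_mul (α s)⁻¹) hs (S.deriv_N s hs)
        ((hasLeftDerivAt_const 1 s).congr_of_eqOn hI hs fun t ht => by
          simp [hΓ.start t ht])
      simp only [← hbr] at hX
      have h1 := h.solve (S.orthonormal s hs) hE (hc' s hs) hP0 hQ0 hP hQ hX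
        (x₀ := 0) (by rw [hX0, zero_smul]) r₀
      rw [h0.1, h0.2] at h1
      have h2 := hXΓ r₀
      rw [h1] at h2
      simpa using h2
    refine ⟨(α s₀)⁻¹ * Γ s₀ r₀, fun s hs => ?_⟩
    rw [eq_of_hasLeftDerivAt_zero hI hc hzero hs₀ hs, mul_inv_cancel_left, hβΓ s hs, hr₀ s hs]
  obtain ⟨a, b, d, hab, hrel⟩ := exists_linear_relation hPQ0 (hPQ r₀) (hrot s₀ hs₀).1
  have hε : ε ≠ 0 := by
    rintro rfl
    simpa using (hrot s₀ hs₀).2.1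
  have hδ : δ ≠ 0 := by
    rintro rfl
    simpa using (hrot s₀ hs₀).2.2.1
  refine ⟨φ, ε, a * ε, b * δ, d, hbij, hε, fun s hs => (hrot s hs).2.2.2.2.1,
    hab.imp (mul_ne_zero · hε) (mul_ne_zero · hδ), fun t ht => ?_⟩
  obtain ⟨s, hs, rfl⟩ := hbij.surjOn ht
  have O := S.orthonormal s hs
  have h1 := congrArg (metricForm g 1 (T s)) (hmate s hs)
  have h2 := congrArg (metricForm g 1 (B s)) (hmate s hs)
  simp [hr' s hs, hr₀ s hs, O.TT, O.TB, O.BB, h.symm (B s) (T s)] at h1 h2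
  have := hrel _ _ _ _ _ (S.pos s hs).ne' h1 h2 (hrot s hs).2.2.2.2.2.1 (hrot s hs).2.2.2.2.2.2
  linear_combination this

/-- The tangent indicatrix is a spherical helix if and only if the principal normal makes a constant
angle with a fixed vector. -/
theorem isSphericalHelix_tangentIndicatrix_iff [FiniteDimensional ℝ E]
    (hE : Module.finrank ℝ E = 3) {g : LieMetric E G} (hg : IsBiInvariant g) {I : Set ℝ} {α : ℝ → G}
    {F : FrenetData E G} (hα : IsFrenetCurve g I α F) :
    IsSphericalHelix g I F.tangentIndicatrix ↔
      ∃ d : E, d ≠ 0 ∧ ∃ k : ℝ, ∀ s ∈ I, metricForm g 1 (F.N s) d = k := by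
  have S := hα.isFrenetSystem hE hg
  let T : ℝ → E := F.T
  let N : ℝ → E := F.N
  have hT : ∀ s ∈ I, deriv T s = F.κ s • N s := fun s hs => (S.deriv_T s hs).deriv
  have hN : ∀ s ∈ I, (√(metricForm g 1 (deriv T s) (deriv T s)))⁻¹ • deriv T s = N s := by
    intro s hs
    have h1 : metricForm g 1 (N s) (N s) = 1 := (S.orthonormal s hs).NN
    have h2 := S.pos s hs
    have h3 : metricForm g 1 (deriv T s) (deriv T s) = F.κ s ^ 2 := by
      rw [hT s hs]; simp [h1, sq]
    rw [h3, Real.sqrt_sq h2.le, hT s hs, smul_smul, inv_mul_cancel₀ h2.ne', one_smul]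
  constructor
  · rintro ⟨-, -, -, d, hd, k, hk⟩
    refine ⟨d, hd, k, fun s hs => ?_⟩
    have h1 : metricForm g 1 ((√(metricForm g 1 (deriv T s) (deriv T s)))⁻¹ • deriv T s) d = k :=
      hk s hs
    rwa [hN s hs] at h1
  · rintro ⟨d, hd, k, hk⟩
    refine ⟨hα.smooth_T, hα.inner_TT, fun s hs => ?_, d, hd, k, fun s hs => ?_⟩
    · have h1 : metricForm g 1 (N s) (N s) = 1 := (S.orthonormal s hs).NN
      change deriv T s ≠ 0
      rw [hT s hs]
      refine smul_ne_zero (S.pos s hs).ne' ?_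
      intro h0
      simp [h0] at h1
    · change metricForm g 1 ((√(metricForm g 1 (deriv T s) (deriv T s)))⁻¹ • deriv T s) d = k
      rw [hN s hs]
      exact hk s hs

/-- Smoothness of the curvature is not part of `IsFrenetCurve`; it follows from κ = ⟨T',N⟩. -/
theorem IsFrenetCurve.contDiffOn_curvature [FiniteDimensional ℝ E]
    (hE : Module.finrank ℝ E = 3) {g : LieMetric E G} (hg : IsBiInvariant g) {I : Set ℝ} {α : ℝ → G}
    {F : FrenetData E G} (hα : IsFrenetCurve g I α F) : ContDiffOn ℝ ∞ F.κ I := by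
  have S := hα.isFrenetSystem hE hg
  let T : ℝ → E := F.T
  let N : ℝ → E := F.N
  have hT : ContDiffOn ℝ ∞ T I := hα.smooth_T
  have hN : ContDiffOn ℝ ∞ N I := hα.smooth_N
  have hT' : ContDiffOn ℝ ∞ (deriv T) I := hT.deriv_of_isOpen hα.isOpen (by simp)
  have h1 : ContDiffOn ℝ ∞ (fun s => metricForm g 1 (deriv T s) (N s)) I :=
    ((metricForm g 1).contDiff.comp_contDiffOn hT').clm_apply hN
  refine h1.congr fun s hs => ?_
  have h2 : metricForm g 1 (N s) (N s) = 1 := (S.orthonormal s hs).NN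
  have h3 : deriv T s = F.κ s • N s := (S.deriv_T s hs).deriv
  rw [h3]
  simp [h2]

end BertrandPairs

/-! ### The equivalence. -/

theorem theorem3p6 {E : Type*} [NormedAddCommGroup E] [NormedSpace ℝ E]
    (hE : Module.finrank ℝ E = 3)
    {G : Type*} [TopologicalSpace G] [ChartedSpace E G] [Group G] [LieGroup 𝓘(ℝ, E) ∞ G]
    (g : LieMetric E G) (hg : IsBiInvariant g)
    (I J : Set ℝ) (α α' : ℝ → G) (F F' : FrenetData E G)
    (hα : IsFrenetCurve g I α F) (hα' : IsFrenetCurve g J α' F')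
    (hpair : IsBertrandPair I α F J α' F')
    (hhelix : ¬ F.IsHelix g I) (hhelix' : ¬ F'.IsHelix g J)
    (hplanar : ¬ F.IsPlanar g I) (hplanar' : ¬ F'.IsPlanar g J)
    (hκ : ∃ s ∈ J, deriv F'.κ s ≠ 0) :
    IsSphericalHelix g I F.tangentIndicatrix ↔
      ∀ s ∈ J, deriv (deriv F'.κ) s * F'.κ s * (1 + F'.harm g s ^ 2)
        - 3 * deriv F'.κ s ^ 2 * (1 + F'.rho g s * F'.harm g s) = 0 := by
  have : FiniteDimensional ℝ E := .of_finrank_pos (by omega)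
  obtain ⟨φ, ε, a, b, d, hbij, hε, hN, hab, hrel⟩ := bertrand_linear_relation hE hg hα hα' hpair
  rw [isSphericalHelix_tangentIndicatrix_iff hE hg hα]
  have S := hα'.isFrenetSystem hE hg
  have hJ := hα'.isOpen
  have hc := hα'.ordConnected.isPreconnected
  have hsymm := metricForm_symm g (1 : G)
  let T : ℝ → E := F'.T
  let N : ℝ → E := F'.N
  let B : ℝ → E := F'.B
  let κ := F'.κ
  let σ : ℝ → ℝ := fun s => F'.τ s - F'.tauG g s
  change IsFrenetSystem (metricForm g 1) J T N B κ σ at S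
  change ∀ s ∈ J, a * κ s + b * σ s = d at hrel
  obtain ⟨s₀, hs₀, hκ₀⟩ := hκ
  have hsm := hα'.contDiffOn_curvature hE hg
  have hderiv : ∀ {f : ℝ → ℝ}, ContDiffOn ℝ ∞ f J → ∀ s ∈ J, HasDerivAt f (deriv f s) s :=
    fun hf s hs => ((hf.contDiffAt (hJ.mem_nhds hs)).differentiableAt (by simp)).hasDerivAt
  have hκ₁ : ∀ s ∈ J, HasDerivAt κ (deriv κ s) s := hderiv hsm
  have hκ₂ : ∀ s ∈ J, HasDerivAt (deriv κ) (deriv (deriv κ) s) s :=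
    hderiv (hsm.deriv_of_isOpen hJ (by simp))
  have hb : b ≠ 0 := by
    rintro rfl
    have ha : a ≠ 0 := by simpa using hab
    have h1 := HasDerivAt.eq_of_eqOn hJ hs₀ ((hκ₁ s₀ hs₀).const_mul a) (hasDerivAt_const s₀ d)
      (fun t ht => by simpa using hrel t ht)
    exact hκ₀ (by simpa [ha] using h1)
  obtain ⟨lam, μ, hσ⟩ : ∃ lam μ : ℝ, ∀ s ∈ J, σ s = μ + lam * κ s := by
    refine ⟨-a / b, d / b, fun s hs => ?_⟩
    have := hrel s hs
    field_simp
    linear_combination this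
  -- For μ = 0 the vector lam T + B is constant and is a helix axis for the mate.
  have hμ : μ ≠ 0 := by
    rintro rfl
    apply hhelix'
    obtain ⟨v, hv⟩ := exists_const_of_hasDerivAt_zero (f := fun s => lam • T s + B s) hJ hc
      (fun s hs => by
        refine (((S.deriv_T s hs).const_smul lam).add (S.deriv_B s hs)).congr_deriv ?_
        rw [hσ s hs]
        module)
    have key : ∀ s ∈ J, metricForm g 1 (T s) v = lam ∧ metricForm g 1 (B s) v = 1 :=
      fun s hs => by
        have O := S.orthonormal s hs
        rw [← hv s hs]
        simp [O.TT, O.TB, hsymm (B s) (T s), O.BB]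
    refine ⟨v, ?_, lam, fun s hs => (key s hs).1⟩
    intro h0
    have h1 := (key s₀ hs₀).2
    have h2 : metricForm g 1 (B s₀) v = 0 := by
      have : v = (0 : E) := h0
      rw [this, map_zero]
    linarith
  have hslant : (∃ d : E, d ≠ 0 ∧ ∃ k : ℝ, ∀ s ∈ I, metricForm g 1 (F.N s) d = k) ↔
      ∃ d : E, d ≠ 0 ∧ ∃ k : ℝ, ∀ s ∈ J, metricForm g 1 (N s) d = k := by
    have h1 : ∀ s ∈ I, ∀ v : E, metricForm g 1 (N (φ s)) v = ε * metricForm g 1 (F.N s) v := by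
      intro s hs v
      have h2 : N (φ s) = ε • (F.N s : E) := hN s hs
      rw [h2]
      exact congrArg (fun f : E →L[ℝ] ℝ => f v) ((metricForm g 1).map_smul ε (F.N s))
    constructor
    · rintro ⟨v, hv, k, hk⟩
      refine ⟨v, hv, ε * k, fun t ht => ?_⟩
      obtain ⟨s, hs, rfl⟩ := hbij.surjOn ht
      rw [h1 s hs, hk s hs]
    · rintro ⟨v, hv, k, hk⟩
      refine ⟨v, hv, k / ε, fun s hs => ?_⟩
      rw [← hk _ (hbij.mapsTo hs), h1 s hs]
      field_simp
  rw [hslant]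
  -- Where κ' = 0, the quotient `rho` has the default value 0, but it is multiplied by κ'² = 0; this
  -- agrees with the convention in the statement.
  have hpoint : ∀ s ∈ J, κ s * (deriv (deriv F'.κ) s * F'.κ s * (1 + F'.harm g s ^ 2)
        - 3 * deriv F'.κ s ^ 2 * (1 + F'.rho g s * F'.harm g s)) =
      deriv (deriv κ) s * (κ s ^ 2 + σ s ^ 2) - 3 * deriv κ s ^ 2 * (κ s + lam * σ s) := by
    intro s hs
    have hp := (S.pos s hs).ne'
    have hH : F'.harm g s = σ s / κ s := rfl
    have hσ' : deriv σ s = lam * deriv κ s :=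
      (((hκ₁ s hs).const_mul lam).const_add μ |>.congr_of_eventuallyEq
        (eventually_of_mem (hJ.mem_nhds hs) hσ)).deriv
    have hρ : F'.rho g s = lam * deriv κ s / deriv κ s := by
      rw [← hσ']; rfl
    change κ s * (deriv (deriv κ) s * κ s * (1 + F'.harm g s ^ 2)
        - 3 * deriv κ s ^ 2 * (1 + F'.rho g s * F'.harm g s)) = _
    rw [hρ, hH]
    rcases eq_or_ne (deriv κ s) 0 with h0 | h0
    · rw [h0]
      field_simp
      ring
    · field_simp
  constructor
  · rintro ⟨v, hv, k, hk⟩ s hs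
    have h1 := S.intrinsic_of_slant hsymm hE hJ hμ hσ hκ₁ hκ₂ hv hk s hs
    rw [← hpoint s hs] at h1
    exact (mul_eq_zero.1 h1).resolve_left (S.pos s hs).ne'
  · intro h
    refine S.slant_of_intrinsic hJ hc ⟨s₀, hs₀⟩ hsymm hσ hκ₁ hκ₂ fun s hs => ?_
    rw [← hpoint s hs, h s hs, mul_zero]
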